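/- Let $\mathcal H$ be a separable Hilbert space and let $G$ be an unbounded positive semidefinite (self-adjoint, densely defined) operator on $\mathcal H$ with $\inf\{\|G\varphi\| : \varphi\in\mathcal D(G),\ \|\varphi\|=1\}=0$. For a positive trace class operator $\rho$ put $\operatorname{Tr}G\rho=\sup_n\operatorname{Tr}P_nG\rho\in[0,\infty]$, where $P_n$ is the spectral projector of $G$ corresponding to $[0,n]$. Let $\mathfrak T_G^+$ be the set of all positive trace class operators $\rho$ with $\operatorname{Tr}G\rho<\infty$, and for $E>0$ let $\mathfrak C_{G,E}$ be the set of all positive trace class operators $\rho$ with $\operatorname{Tr}\rho\le 1$ and $\operatorname{Tr}G\rho\le E$. A linear operator $A:\mathcal D(\sqrt G)\to\mathcal H$ is $\sqrt G$-bounded if there are $a,b\ge 0$ such that $\|A\varphi\|^2\le a^2\|\varphi\|^2+b^2\|\sqrt G\varphi\|^2$ for all $\varphi\in\mathcal D(\sqrt G)$; the infimum of all such $b$ is the $\sqrt G$-bound of $A$, and $A$ is $\sqrt G$-infinitesimal if its $\sqrt G$-bound is $0$. For $E>0$ put $$\|A\|^G_E=\sup\{\|A\varphi\| : \varphi\in\mathcal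 D(\sqrt G),\ \|\varphi\|=1,\ \|\sqrt G\varphi\|^2\le E\}.$$ For $\sqrt G$-bounded $A,B$ and $\rho\in\mathfrak T_G^+$, put $A\rho B^*=\sum_i|A\varphi_i\rangle\langle B\varphi_i|$, where $\rho=\sum_i|\varphi_i\rangle\langle\varphi_i|$ is any countable decomposition of $\rho$. This is a well-defined trace class operator: all $\varphi_i$ lie in $\mathcal D(\sqrt G)$, and the sum does not depend on the decomposition. 1. If $A$ and $B$ are $\sqrt G$-bounded and $\sqrt G$-infinitesimal, then for every $E>0$ the function $\rho\mapsto A\rho B^*$ is uniformly continuous on $\mathfrak C_{G,E}$ with respect to the trace norm $\|\cdot\|_1$. Quantitatively, for every $\varepsilon>0$ and all $\rho,\sigma\in\mathfrak C_{G,E}$ with $\|\rho-\sigma\|_1\le\varepsilon$, $$\|A\rho B^*-A\sigma B^*\|_1\le\sqrt{\varepsilon}\left(\|A\|^G_E\|B\|^G_{4E/\varepsilon}+\|B\|^G_E\|A\|^G_{4E/\varepsilon}\right),$$ and the right-hand side tends to $0$ as $\varepsilon\to0^+$. 2. If $A$ is $\sqrt G$-bounded but not $\sqrt G$-infinitesimal,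 then for every $E>0$ the function $\rho\mapsto A\rho A^*$ is not continuous on $\mathfrak C_{G,E}$ with respect to the trace norm. -/

import Mathlib

open scoped ENNReal

namespace OpENorm

variable {H : Type*} [NormedAddCommGroup H] [InnerProductSpace ℂ H] [CompleteSpace H]

/-- A (possibly unbounded) positive semidefinite densely defined self-adjoint operator on `H`
(density of the domain is a consequence of self-adjointness in Mathlib's sense). -/
structure PosOp (H : Type*) [NormedAddCommGroup H] [InnerProductSpace ℂ H] [CompleteSpace H] where
  op : H →ₗ.[ℂ] H
  selfAdjoint : IsSelfAdjoint op
  nonneg : ∀ x : op.domain, 0 ≤ (inner ℂ (x : H) (op x)).re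

namespace PosOp

variable (G : PosOp H)

theorem graph_symm {x u y v : H} (h : (x, u) ∈ G.op.graph) (k : (y, v) ∈ G.op.graph) :
    inner ℂ u y = inner ℂ x v := by
  obtain ⟨a, rfl, rfl⟩ := G.op.mem_graph_iff.1 h
  obtain ⟨b, rfl, rfl⟩ := G.op.mem_graph_iff.1 k
  have h1 := LinearPMap.adjoint_isFormalAdjoint (T := G.op) G.selfAdjoint.dense_domain
  rw [LinearPMap.isSelfAdjoint_def.1 G.selfAdjoint] at h1
  exact h1 a b

theorem graph_nonneg {x u : H} (h : (x, u) ∈ G.op.graph) : 0 ≤ (inner ℂ x u).re := by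
  obtain ⟨a, rfl, rfl⟩ := G.op.mem_graph_iff.1 h
  exact G.nonneg a

theorem graph_maximal {y w : H} (h : ∀ x u : H, (x, u) ∈ G.op.graph → inner ℂ w x = inner ℂ y u) :
    (y, w) ∈ G.op.graph := by
  have hd := G.selfAdjoint.dense_domain
  have h' : ∀ x : G.op.domain, inner ℂ w (x : H) = inner ℂ y (G.op x) :=
    fun x => h x (G.op x) (G.op.mem_graph x)
  have h1 := LinearPMap.mem_adjoint_domain_of_exists (T := G.op) y ⟨w, h'⟩
  have h2 := LinearPMap.adjoint_apply_eq hd ⟨y, h1⟩ h'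
  have h3 := (LinearPMap.adjoint G.op).mem_graph ⟨y, h1⟩
  rw [h2] at h3
  have h4 : (LinearPMap.adjoint G.op).graph = G.op.graph :=
    congrArg LinearPMap.graph (LinearPMap.isSelfAdjoint_def.1 G.selfAdjoint)
  exact h4 ▸ h3

/-- `1 + G` is a bijection of the domain of `G` onto `H` with a bounded inverse. -/
theorem exists_resolvent : ∃ R : H →L[ℂ] H, ∀ y, (R y, y - R y) ∈ G.op.graph := by
  have hcl : IsClosed (G.op.graph : Set (H × H)) := G.selfAdjoint.isClosed
  have : CompleteSpace G.op.graph := hcl.completeSpace_coe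
  let L : G.op.graph →L[ℂ] H :=
    (ContinuousLinearMap.fst ℂ H H + ContinuousLinearMap.snd ℂ H H).comp G.op.graph.subtypeL
  have hL : ∀ p : G.op.graph, L p = (p : H × H).1 + (p : H × H).2 := fun p => rfl
  have hb : ∀ p : G.op.graph, ‖p‖ ≤ ‖L p‖ := by
    rintro ⟨⟨x, u⟩, h⟩
    have h0 := G.graph_nonneg h
    have h1 := norm_add_sq (𝕜 := ℂ) x u
    rw [hL]
    have h2 : ‖(⟨(x, u), h⟩ : G.op.graph)‖ = max ‖x‖ ‖u‖ := rfl
    simp only [RCLike.re_to_complex] at h1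
    rw [h2]
    refine max_le ?_ ?_ <;> refine abs_le_of_sq_le_sq' ?_ (norm_nonneg _) |>.2 <;>
      simp only [h1] <;> nlinarith [sq_nonneg ‖x‖, sq_nonneg ‖u‖]
  have hanti : AntilipschitzWith 1 L := by
    refine AddMonoidHomClass.antilipschitz_of_bound L (K := 1) ?_
    intro p; simpa using hb p
  have hclr : IsClosed (L.range : Set H) := by
    exact hanti.isClosed_range L.uniformContinuous
  have hsurj : L.range = ⊤ := by
    have : CompleteSpace L.range := hclr.completeSpace_coe
    rw [← Submodule.orthogonal_eq_bot_iff, Submodule.eq_bot_iff]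
    intro z hz
    have h1 : (z, -z) ∈ G.op.graph := by
      refine G.graph_maximal fun x u h => ?_
      have := (Submodule.mem_orthogonal' _ _).1 hz (L ⟨(x, u), h⟩) ⟨_, rfl⟩
      rw [hL, inner_add_right] at this
      rw [inner_neg_left]
      linear_combination -this
    have h2 := G.graph_nonneg h1
    rw [inner_neg_right, inner_self_eq_norm_sq_to_K] at h2
    have h3 : ‖z‖ ^ 2 ≤ 0 := by
      have : (-((‖z‖ : ℂ) ^ 2)).re = -‖z‖ ^ 2 := by norm_cast
      have h2' : 0 ≤ (-((‖z‖ : ℂ) ^ 2)).re := h2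
      linarith
    exact norm_eq_zero.1 (pow_eq_zero_iff two_ne_zero |>.1 (le_antisymm h3 (sq_nonneg _)))
  have hinj : L.ker = ⊥ := LinearMap.ker_eq_bot.2 hanti.injective
  let e := ContinuousLinearEquiv.ofBijective L hinj hsurj
  refine ⟨(ContinuousLinearMap.fst ℂ H H).comp (G.op.graph.subtypeL.comp
    (e.symm : H →L[ℂ] G.op.graph)), fun y => ?_⟩
  have h1 : L (e.symm y) = y := ContinuousLinearEquiv.ofBijective_apply_symm_apply L hinj hsurj y
  rw [hL] at h1
  have h2 : y - (e.symm y : H × H).1 = (e.symm y : H × H).2 := by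
    rw [sub_eq_iff_eq_add']; exact h1.symm
  change ((e.symm y : H × H).1, y - (e.symm y : H × H).1) ∈ G.op.graph
  rw [h2]
  exact (e.symm y).2

/-- The resolvent `(1 + G)⁻¹`, a bounded operator. -/
noncomputable def res : H →L[ℂ] H := G.exists_resolvent.choose

theorem res_graph (y : H) : (G.res y, y - G.res y) ∈ G.op.graph :=
  G.exists_resolvent.choose_spec y

theorem res_add {x u : H} (h : (x, u) ∈ G.op.graph) : G.res (x + u) = x := by
  have h1 := G.op.graph.sub_mem (G.res_graph (x + u)) h
  have h2 := G.graph_nonneg h1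
  set d := G.res (x + u) - x
  have h3 : ((x + u) - G.res (x + u)) - u = -d := by simp only [d]; abel
  simp only [h3] at h2
  rw [inner_neg_right, inner_self_eq_norm_sq_to_K] at h2
  have : (-((‖d‖ : ℂ) ^ 2)).re = -‖d‖ ^ 2 := by norm_cast
  have h2' : 0 ≤ (-((‖d‖ : ℂ) ^ 2)).re := h2
  have h4 : ‖d‖ ^ 2 = 0 := le_antisymm (by linarith) (sq_nonneg _)
  exact sub_eq_zero.1 (norm_eq_zero.1 (pow_eq_zero_iff two_ne_zero |>.1 h4))

theorem res_injective : Function.Injective G.res := by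
  refine (injective_iff_map_eq_zero G.res).2 fun y hy => ?_
  have h := G.res_graph y
  rw [hy, sub_zero] at h
  exact G.op.graph_fst_eq_zero_snd h rfl

theorem res_symm (x y : H) : inner ℂ (G.res x) y = inner ℂ x (G.res y) := by
  have h := G.graph_symm (G.res_graph x) (G.res_graph y)
  rw [inner_sub_left, inner_sub_right] at h
  linear_combination -h

theorem res_nonneg : 0 ≤ G.res := by
  rw [ContinuousLinearMap.nonneg_iff_isPositive]
  refine ⟨fun x y => G.res_symm x y, fun x => ?_⟩
  have h := G.graph_nonneg (G.res_graph x)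
  rw [inner_sub_right, inner_self_eq_norm_sq_to_K] at h
  have h1 : 0 ≤ (inner ℂ (G.res x) x).re - ‖G.res x‖ ^ 2 := by
    convert h using 1
    rw [Complex.sub_re]; norm_cast
  change 0 ≤ (inner ℂ (G.res x) x).re
  nlinarith [sq_nonneg ‖G.res x‖]

theorem res_le_one : 0 ≤ 1 - G.res := by
  rw [ContinuousLinearMap.nonneg_iff_isPositive]
  refine ⟨fun x y => ?_, fun x => ?_⟩
  · change inner ℂ (x - G.res x) y = inner ℂ x (y - G.res y)
    rw [inner_sub_left, inner_sub_right, G.res_symm]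
  · have h := G.graph_nonneg (G.res_graph x)
    change 0 ≤ (inner ℂ (x - G.res x) x).re
    have h1 : inner ℂ (x - G.res x) x
        = inner ℂ (x - G.res x) (x - G.res x) + inner ℂ (x - G.res x) (G.res x) := by
      rw [← inner_add_right, sub_add_cancel]
    rw [h1, Complex.add_re]
    have h2 : (inner ℂ (x - G.res x) (G.res x)).re = (inner ℂ (G.res x) (x - G.res x)).re :=
      inner_re_symm (𝕜 := ℂ) _ _
    have h3 : 0 ≤ (inner ℂ (x - G.res x) (x - G.res x)).re :=
      inner_self_nonneg (𝕜 := ℂ) (x := x - G.res x)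
    rw [h2]; linarith

/-- `√R` for the resolvent `R = (1 + G)⁻¹`. -/
noncomputable def sqrtRes : H →L[ℂ] H := CFC.sqrt G.res

/-- `√(1 - R)` for the resolvent `R = (1 + G)⁻¹`. -/
noncomputable def sqrtCompl : H →L[ℂ] H := CFC.sqrt (1 - G.res)

theorem commute_sqrts : Commute G.sqrtRes G.sqrtCompl := by
  have h0 : Commute G.res (1 - G.res) := (Commute.one_right _).sub_right (Commute.refl _)
  exact ((h0.cfcₙ_nnreal NNReal.sqrt).symm.cfcₙ_nnreal NNReal.sqrt).symm

theorem sqrtRes_nonneg : 0 ≤ G.sqrtRes := CFC.sqrt_nonneg _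

theorem sqrtCompl_nonneg : 0 ≤ G.sqrtCompl := CFC.sqrt_nonneg _

theorem sqrtRes_symm (x y : H) : inner ℂ (G.sqrtRes x) y = inner ℂ x (G.sqrtRes y) :=
  ((ContinuousLinearMap.nonneg_iff_isPositive _).1 G.sqrtRes_nonneg).isSymmetric x y

theorem sqrtCompl_symm (x y : H) : inner ℂ (G.sqrtCompl x) y = inner ℂ x (G.sqrtCompl y) :=
  ((ContinuousLinearMap.nonneg_iff_isPositive _).1 G.sqrtCompl_nonneg).isSymmetric x y

theorem sqrt_comm (x : H) : G.sqrtRes (G.sqrtCompl x) = G.sqrtCompl (G.sqrtRes x) :=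
  congrArg (fun T : H →L[ℂ] H => T x) G.commute_sqrts.eq

theorem sqrtRes_sqrtRes (x : H) : G.sqrtRes (G.sqrtRes x) = G.res x :=
  congrArg (fun T : H →L[ℂ] H => T x) (CFC.sqrt_mul_sqrt_self _ G.res_nonneg)

theorem sqrtCompl_sqrtCompl (x : H) : G.sqrtCompl (G.sqrtCompl x) = x - G.res x :=
  congrArg (fun T : H →L[ℂ] H => T x) (CFC.sqrt_mul_sqrt_self _ G.res_le_one)

theorem sqrtRes_injective : Function.Injective G.sqrtRes.toLinearMap := by
  intro x y h
  have h' : G.sqrtRes x = G.sqrtRes y := h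
  apply G.res_injective
  rw [← sqrtRes_sqrtRes, ← sqrtRes_sqrtRes, h']

/-- The positive square root `√G`, built from the bounded operator `R = (1 + G)⁻¹`:
its domain is the range of `√R`, and it maps `√R ψ` to `√(1 - R) ψ`. By `sqrt_nonneg`,
`sqrt_selfAdjoint` and `sqrt_sqrt` below it is the positive self-adjoint operator with square
`G`, domains included. -/
noncomputable def sqrt : H →ₗ.[ℂ] H where
  domain := G.sqrtRes.toLinearMap.range
  toFun := G.sqrtCompl.toLinearMap ∘ₗ
    (LinearEquiv.ofInjective G.sqrtRes.toLinearMap G.sqrtRes_injective).symm.toLinearMap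

theorem sqrt_apply (ψ : H) (h : G.sqrtRes ψ ∈ G.sqrt.domain) :
    G.sqrt ⟨G.sqrtRes ψ, h⟩ = G.sqrtCompl ψ :=
  congrArg G.sqrtCompl
    ((LinearEquiv.ofInjective G.sqrtRes.toLinearMap G.sqrtRes_injective).symm_apply_apply ψ)

theorem mem_sqrt_graph {x u : H} : (x, u) ∈ G.sqrt.graph ↔
    ∃ ψ, x = G.sqrtRes ψ ∧ u = G.sqrtCompl ψ := by
  constructor
  · intro h
    obtain ⟨⟨a, ψ, rfl⟩, rfl, rfl⟩ := G.sqrt.mem_graph_iff.1 h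
    exact ⟨ψ, rfl, G.sqrt_apply ψ _⟩
  · rintro ⟨ψ, rfl, rfl⟩
    exact G.sqrt.mem_graph_iff.2 ⟨⟨_, ψ, rfl⟩, rfl, G.sqrt_apply ψ _⟩

theorem sqrt_nonneg (x : G.sqrt.domain) : 0 ≤ (inner ℂ (x : H) (G.sqrt x)).re := by
  obtain ⟨ψ, h1, h2⟩ := G.mem_sqrt_graph.1 (G.sqrt.mem_graph x)
  have h3 := Commute.mul_nonneg G.sqrtRes_nonneg G.sqrtCompl_nonneg G.commute_sqrts
  have h4 := ((ContinuousLinearMap.nonneg_iff_isPositive _).1 h3).re_inner_nonneg_right ψ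
  rw [h1, h2, sqrtRes_symm]
  exact h4

/-- `√G` is self-adjoint. -/
theorem sqrt_selfAdjoint : IsSelfAdjoint G.sqrt := by
  have hsymm : ∀ x y : G.sqrt.domain, inner ℂ (G.sqrt x) (y : H) = inner ℂ (x : H) (G.sqrt y) := by
    intro x y
    obtain ⟨ψ, h1, h2⟩ := G.mem_sqrt_graph.1 (G.sqrt.mem_graph x)
    obtain ⟨χ, k1, k2⟩ := G.mem_sqrt_graph.1 (G.sqrt.mem_graph y)
    rw [h1, h2, k1, k2, sqrtCompl_symm, sqrtRes_symm, sqrt_comm]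
  have hd : Dense (G.sqrt.domain : Set H) := by
    rw [Submodule.dense_iff_topologicalClosure_eq_top,
      Submodule.topologicalClosure_eq_top_iff, Submodule.eq_bot_iff]
    intro z hz
    apply G.sqrtRes_injective
    rw [map_zero]
    refine ext_inner_right ℂ fun y => ?_
    change inner ℂ (G.sqrtRes z) y = _
    rw [sqrtRes_symm, inner_zero_left]
    exact (Submodule.mem_orthogonal' _ _).1 hz _ ⟨y, rfl⟩
  rw [LinearPMap.isSelfAdjoint_def]
  refine le_antisymm ?_ (LinearPMap.IsFormalAdjoint.le_adjoint hd hsymm)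
  refine LinearPMap.le_of_le_graph ?_
  rintro ⟨y, w⟩ h
  obtain ⟨⟨a, ha⟩, rfl, rfl⟩ := (LinearPMap.adjoint G.sqrt).mem_graph_iff.1 h
  set w := LinearPMap.adjoint G.sqrt ⟨a, ha⟩ with hw
  have h1 : G.sqrtRes w = G.sqrtCompl a := by
    refine ext_inner_right ℂ fun ψ => ?_
    rw [sqrtRes_symm, sqrtCompl_symm]
    obtain ⟨x, hx1, hx2⟩ := G.sqrt.mem_graph_iff.1 (G.mem_sqrt_graph.2 ⟨ψ, rfl, rfl⟩)
    have h2 : inner ℂ w (x : H) = inner ℂ a (G.sqrt x) :=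
      LinearPMap.adjoint_isFormalAdjoint hd ⟨a, ha⟩ x
    rw [hx1, hx2] at h2
    exact h2
  refine G.mem_sqrt_graph.2 ⟨G.sqrtRes a + G.sqrtCompl w, ?_, ?_⟩
  · change a = _
    rw [map_add, sqrtRes_sqrtRes, sqrt_comm, h1, sqrtCompl_sqrtCompl]; abel
  · rw [map_add, sqrtCompl_sqrtCompl, ← sqrt_comm, ← h1, sqrtRes_sqrtRes]; abel

/-- `√G √G = G`, including the domains. -/
theorem sqrt_sqrt (x y : H) : (x, y) ∈ G.op.graph ↔
    ∃ z, (x, z) ∈ G.sqrt.graph ∧ (z, y) ∈ G.sqrt.graph := by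
  constructor
  · intro h
    have h1 := G.res_add h
    refine ⟨G.sqrtCompl (G.sqrtRes (x + y)), G.mem_sqrt_graph.2
      ⟨G.sqrtRes (x + y), ?_, rfl⟩, G.mem_sqrt_graph.2
      ⟨G.sqrtCompl (x + y), ?_, ?_⟩⟩
    · rw [sqrtRes_sqrtRes, h1]
    · rw [sqrt_comm]
    · rw [sqrtCompl_sqrtCompl, h1]; abel
  · rintro ⟨z, h, k⟩
    obtain ⟨ψ, rfl, rfl⟩ := G.mem_sqrt_graph.1 h
    obtain ⟨χ, k1, rfl⟩ := G.mem_sqrt_graph.1 k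
    have h1 : ψ = G.sqrtRes (G.sqrtRes ψ + G.sqrtCompl χ) := by
      rw [map_add, sqrtRes_sqrtRes, sqrt_comm, ← k1, sqrtCompl_sqrtCompl]; abel
    have h2 := G.res_graph (G.sqrtRes ψ + G.sqrtCompl χ)
    rw [← sqrtRes_sqrtRes, ← h1] at h2
    simpa using h2


/-- The positive part of `1/(1+n) - R` for the resolvent `R = (1 + G)⁻¹`. -/
noncomputable def cut (n : ℕ) : H →L[ℂ] H :=
  (algebraMap ℝ (H →L[ℂ] H) (1 / (1 + n : ℝ)) - G.res)⁺

/-- The negative part of `1/(1+n) - R` for the resolvent `R = (1 + G)⁻¹`. -/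
noncomputable def cutNeg (n : ℕ) : H →L[ℂ] H :=
  (algebraMap ℝ (H →L[ℂ] H) (1 / (1 + n : ℝ)) - G.res)⁻

/-- The spectral projector of `G` corresponding to the interval `[0, n]`. In terms of the resolvent
`R = (1 + G)⁻¹` this is the spectral projector of `R` for `[1/(1+n), 1]`, that is, the orthogonal
projector onto the kernel of the positive part of `1/(1+n) - R`. The theorems below characterise
it: it reduces `G`, `G ≤ n` on its range, and `G > n` on its kernel. -/
noncomputable def specProj (n : ℕ) : H →L[ℂ] H := (G.cut n).ker.starProjection

theorem cut_nonneg (n : ℕ) : 0 ≤ G.cut n := CFC.posPart_nonneg _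

theorem cutNeg_nonneg (n : ℕ) : 0 ≤ G.cutNeg n := CFC.negPart_nonneg _

theorem cut_symm (n : ℕ) (x y : H) : inner ℂ (G.cut n x) y = inner ℂ x (G.cut n y) :=
  ((ContinuousLinearMap.nonneg_iff_isPositive _).1 (G.cut_nonneg n)).isSymmetric x y

theorem cutNeg_symm (n : ℕ) (x y : H) : inner ℂ (G.cutNeg n x) y = inner ℂ x (G.cutNeg n y) :=
  ((ContinuousLinearMap.nonneg_iff_isPositive _).1 (G.cutNeg_nonneg n)).isSymmetric x y

theorem cut_cutNeg (n : ℕ) (x : H) : G.cut n (G.cutNeg n x) = 0 :=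
  congrArg (fun T : H →L[ℂ] H => T x) (CFC.posPart_mul_negPart _)

theorem cut_sub (n : ℕ) (x : H) :
    G.cut n x - G.cutNeg n x = ((1 / (1 + n : ℝ) : ℝ) : ℂ) • x - G.res x := by
  have h0 : IsSelfAdjoint (algebraMap ℝ (H →L[ℂ] H) (1 / (1 + n : ℝ)) - G.res) :=
    (IsSelfAdjoint.algebraMap _ (IsSelfAdjoint.all _)).sub (IsSelfAdjoint.of_nonneg G.res_nonneg)
  have h := congrArg (fun T : H →L[ℂ] H => T x) (CFC.posPart_sub_negPart _ h0)
  refine h.trans ?_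
  rw [Algebra.algebraMap_eq_smul_one, Complex.coe_smul]
  rfl

theorem commute_cut (n : ℕ) : Commute G.res (G.cut n) := by
  have h : Commute (algebraMap ℝ (H →L[ℂ] H) (1 / (1 + n : ℝ)) - G.res) G.res :=
    Commute.sub_left (Algebra.commutes _ _) (Commute.refl _)
  exact (h.cfcₙ_real (fun x : ℝ => x⁺)).symm

theorem commute_sqrtRes_cut (n : ℕ) : Commute G.sqrtRes (G.cut n) :=
  (G.commute_cut n).cfcₙ_nnreal NNReal.sqrt

theorem mem_ker_cut (n : ℕ) (x : H) : x ∈ (G.cut n).ker ↔ G.cut n x = 0 := Iff.rfl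

theorem specProj_commute (n : ℕ) (x : H) : G.specProj n (G.res x) = G.res (G.specProj n x) := by
  have hinv : ∀ y ∈ (G.cut n).ker, G.res y ∈ (G.cut n).ker := by
    intro y hy
    have h : G.res (G.cut n y) = G.cut n (G.res y) :=
      congrArg (fun T : H →L[ℂ] H => T y) (G.commute_cut n).eq
    rw [mem_ker_cut] at hy ⊢
    rw [← h, hy, map_zero]
  refine Submodule.eq_starProjection_of_mem_orthogonal (hinv _ ?_) ?_
  · exact Submodule.starProjection_apply_mem _ x
  · rw [← map_sub, Submodule.mem_orthogonal]
    intro y hy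
    rw [← G.res_symm]
    exact Submodule.inner_right_of_mem_orthogonal (hinv y hy)
      (Submodule.sub_starProjection_mem_orthogonal x)

/-- `P G ⊆ G P` for the spectral projector `P`. -/
theorem specProj_graph (n : ℕ) {x u : H} (h : (x, u) ∈ G.op.graph) :
    (G.specProj n x, G.specProj n u) ∈ G.op.graph := by
  have h1 := G.res_graph (G.specProj n (x + u))
  rw [← specProj_commute, G.res_add h, map_add, add_sub_cancel_left] at h1
  exact h1

theorem exists_of_mem_ker_cut (n : ℕ) {x : H} (hx : x ∈ (G.cut n).ker) :
    ∃ y, G.res y = x ∧ x = ((1 / (1 + n : ℝ) : ℝ) : ℂ) • y + G.cutNeg n y := by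
  have hr : (0 : ℝ) < 1 / (1 + n : ℝ) := by positivity
  set r : ℝ := 1 / (1 + n : ℝ) with hrdef
  have hB : IsUnit (algebraMap ℝ (H →L[ℂ] H) r + G.cutNeg n) := by
    have hs : IsStrictlyPositive (algebraMap ℝ (H →L[ℂ] H) r) := by
      refine (IsStrictlyPositive.iff_of_unital).2 ⟨?_, ?_⟩
      · exact algebraMap_nonneg _ hr.le
      · exact (IsUnit.mk0 r hr.ne').map _
    exact (hs.add_nonneg (G.cutNeg_nonneg n)).isUnit
  obtain ⟨B, hB⟩ := hB
  have hBx : ∀ z, (B : H →L[ℂ] H) z = (r : ℂ) • z + G.cutNeg n z := by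
    intro z
    rw [hB, Algebra.algebraMap_eq_smul_one, Complex.coe_smul]
    rfl
  set y := (↑B⁻¹ : H →L[ℂ] H) x with hy
  have hxy : (B : H →L[ℂ] H) y = x := congrArg (fun T : H →L[ℂ] H => T x) B.mul_inv
  rw [hBx] at hxy
  have hny : G.cut n y = 0 := by
    have h1 : G.cut n x = 0 := hx
    rw [← hxy, map_add, map_smul, cut_cutNeg, add_zero] at h1
    exact (smul_eq_zero.1 h1).resolve_left (by exact_mod_cast hr.ne')
  refine ⟨y, ?_, hxy.symm⟩
  have h2 := G.cut_sub n y
  rw [hny] at h2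
  have h3 : G.res y = ((r : ℝ) : ℂ) • y - (0 - G.cutNeg n y) := by rw [h2]; abel
  rw [h3, ← hxy]; abel

theorem specProj_mem_domain (n : ℕ) (x : H) : G.specProj n x ∈ G.op.domain := by
  obtain ⟨y, hy, -⟩ := G.exists_of_mem_ker_cut n
    (Submodule.starProjection_apply_mem (G.cut n).ker x)
  have h := LinearPMap.mem_domain_of_mem_graph (G.res_graph y)
  rw [hy] at h
  exact h

/-- `G ≤ n` on the range of the spectral projector for `[0, n]`. -/
theorem specProj_le (n : ℕ) {x u : H} (h : (x, u) ∈ G.op.graph) (hx : G.specProj n x = x) :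
    (inner ℂ x u).re ≤ n * ‖x‖ ^ 2 := by
  have hxk : x ∈ (G.cut n).ker := hx ▸ Submodule.starProjection_apply_mem (G.cut n).ker x
  obtain ⟨y, hy, hxy⟩ := G.exists_of_mem_ker_cut n hxk
  have hr : (0 : ℝ) < 1 / (1 + n : ℝ) := by positivity
  have hrn : (1 / (1 + n : ℝ)) * (1 + n) = 1 := by field_simp
  set r : ℝ := 1 / (1 + n : ℝ) with hrdef
  have hu : u = y - x := by
    have h1 := G.res_graph y
    rw [hy] at h1
    exact LinearPMap.mem_graph_snd_inj _ h h1 rfl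
  have h1 : 0 ≤ (inner ℂ y (G.cutNeg n y)).re :=
    ((ContinuousLinearMap.nonneg_iff_isPositive _).1 (G.cutNeg_nonneg n)).re_inner_nonneg_right y
  have hself : ∀ z : H, (inner ℂ z z).re = ‖z‖ ^ 2 := fun z => inner_self_eq_norm_sq (𝕜 := ℂ) z
  have h2 : 0 ≤ (inner ℂ x (G.cutNeg n y)).re := by
    rw [hxy, inner_add_left, inner_smul_left, Complex.conj_ofReal, Complex.add_re,
      Complex.re_ofReal_mul, hself]
    positivity
  have h3 : ‖x‖ ^ 2 = r * (inner ℂ x y).re + (inner ℂ x (G.cutNeg n y)).re := by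
    rw [← hself]
    conv_lhs => rw [hxy, ← hxy]
    nth_rewrite 2 [hxy]
    rw [inner_add_right, inner_smul_right, Complex.add_re, Complex.re_ofReal_mul]
  rw [hu, inner_sub_right, Complex.sub_re, hself]
  have h4 : (inner ℂ x y).re = (1 + n) * (r * (inner ℂ x y).re) := by
    linear_combination (-(inner ℂ x y).re) * hrn
  have h5 : r * (inner ℂ x y).re ≤ ‖x‖ ^ 2 := by linarith
  have h6 : (0 : ℝ) ≤ 1 + n := by positivity
  nlinarith [mul_le_mul_of_nonneg_left h5 h6]

/-- `G > n` on the kernel of the spectral projector for `[0, n]`. -/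
theorem lt_of_specProj_eq_zero (n : ℕ) {x u : H} (h : (x, u) ∈ G.op.graph)
    (hx : G.specProj n x = 0) (hx0 : x ≠ 0) : n * ‖x‖ ^ 2 < (inner ℂ x u).re := by
  have hself : ∀ z : H, (inner ℂ z z).re = ‖z‖ ^ 2 := fun z => inner_self_eq_norm_sq (𝕜 := ℂ) z
  have hrn : (1 / (1 + n : ℝ)) * (1 + n) = 1 := by field_simp
  set r : ℝ := 1 / (1 + n : ℝ) with hrdef
  have hxz := G.res_add h
  set z := x + u with hz
  have hu : u = z - x := by rw [hz]; abel
  have hPz : G.specProj n z = 0 := by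
    apply G.res_injective
    rw [← specProj_commute, hxz, hx, map_zero]
  have hzo : z ∈ (G.cut n).kerᗮ := (Submodule.starProjection_apply_eq_zero_iff _).1 hPz
  have hMk : ∀ w, G.cutNeg n w ∈ (G.cut n).ker := fun w => G.cut_cutNeg n w
  have hMz : G.cutNeg n z = 0 := by
    rw [← inner_self_eq_zero (𝕜 := ℂ), cutNeg_symm]
    exact Submodule.inner_left_of_mem_orthogonal (hMk _) hzo
  have h1 := G.cut_sub n z
  rw [hMz, sub_zero, hxz] at h1
  have hcomm : ∀ w, G.sqrtRes (G.cut n w) = G.cut n (G.sqrtRes w) := fun w =>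
    congrArg (fun T : H →L[ℂ] H => T w) (G.commute_sqrtRes_cut n).eq
  have h2 : inner ℂ x (G.cut n z) = inner ℂ (G.sqrtRes z) (G.cut n (G.sqrtRes z)) := by
    rw [← hxz, ← sqrtRes_sqrtRes, sqrtRes_symm, hcomm]
  set D : H →L[ℂ] H := CFC.sqrt (G.cut n) with hD
  have hDD : ∀ w, D (D w) = G.cut n w := fun w =>
    congrArg (fun T : H →L[ℂ] H => T w) (CFC.sqrt_mul_sqrt_self _ (G.cut_nonneg n))
  have hDs : ∀ v w, inner ℂ (D v) w = inner ℂ v (D w) := fun v w =>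
    ((ContinuousLinearMap.nonneg_iff_isPositive D).1 (CFC.sqrt_nonneg _)).isSymmetric v w
  have h3 : (inner ℂ x (G.cut n z)).re = ‖D (G.sqrtRes z)‖ ^ 2 := by
    rw [h2, ← hDD, ← hDs, hself]
  have h4 : 0 < ‖D (G.sqrtRes z)‖ := by
    rw [norm_pos_iff]
    intro h0
    have h5 : G.cut n (G.sqrtRes z) = 0 := by rw [← hDD, h0, map_zero]
    rw [← hcomm] at h5
    have h6 : G.cut n z = 0 := by
      apply G.sqrtRes_injective
      change G.sqrtRes _ = G.sqrtRes 0
      rw [h5, map_zero]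
    have h7 : z = 0 := by
      rw [← inner_self_eq_zero (𝕜 := ℂ)]
      exact Submodule.inner_right_of_mem_orthogonal (K := (G.cut n).ker) h6 hzo
    exact hx0 (by rw [← hxz, h7, map_zero])
  rw [h1, inner_sub_right, inner_smul_right, Complex.sub_re, Complex.re_ofReal_mul, hself] at h3
  rw [hu, inner_sub_right, Complex.sub_re, hself]
  have h8 : (inner ℂ x z).re = (1 + n) * (r * (inner ℂ x z).re) := by
    linear_combination (-(inner ℂ x z).re) * hrn
  have h9 : (0 : ℝ) < 1 + n := by positivity
  have h10 : ‖x‖ ^ 2 < r * (inner ℂ x z).re := by nlinarith [pow_pos h4 2]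
  nlinarith [mul_lt_mul_of_pos_left h10 h9]

/-- The everywhere defined operator `G P`, where `P` is the spectral projector of `G` for `[0, n]`;
it is the bounded extension of `P G`. -/
noncomputable def truncation (n : ℕ) : H →ₗ[ℂ] H :=
  G.op.toFun ∘ₗ (G.specProj n).toLinearMap.codRestrict G.op.domain (G.specProj_mem_domain n)

end PosOp

section TraceClass

/-- An index set of an orthonormal basis of `H`. -/
noncomputable def basisIndex (H : Type*) [NormedAddCommGroup H] [InnerProductSpace ℂ H]
    [CompleteSpace H] : Set H := (exists_hilbertBasis ℂ H).choose

/-- An orthonormal (Hilbert) basis of `H`, used to compute traces. -/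
noncomputable def basis (H : Type*) [NormedAddCommGroup H] [InnerProductSpace ℂ H]
    [CompleteSpace H] : HilbertBasis (basisIndex H) ℂ H :=
  (exists_hilbertBasis ℂ H).choose_spec.choose

/-- The trace `Tr T = ∑ᵢ ⟨eᵢ, T eᵢ⟩` (meaningful for trace class operators). -/
noncomputable def trace (T : H →ₗ[ℂ] H) : ℂ := ∑' i, inner ℂ (basis H i) (T (basis H i))

/-- The trace norm `‖T‖₁ = Tr |T|`, with `|T| = √(T* T)`, as an extended nonnegative number. -/
noncomputable def traceNorm (T : H →L[ℂ] H) : ℝ≥0∞ :=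
  ∑' i, ENNReal.ofReal (inner ℂ (basis H i) (CFC.abs T (basis H i))).re

/-- `T` is a trace class operator. -/
def IsTraceClass (T : H →L[ℂ] H) : Prop := traceNorm T ≠ ∞

/-- The cone of positive trace class operators. -/
def traceClassPos (H : Type*) [NormedAddCommGroup H] [InnerProductSpace ℂ H]
    [CompleteSpace H] : Set (H →L[ℂ] H) := {ρ | ρ.IsPositive ∧ IsTraceClass ρ}

/-- The family `φ` gives a decomposition `ρ = ∑ᵢ |φᵢ⟩⟨φᵢ|`. Finite decompositions are included, as
vectors `φᵢ` may be zero. -/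
def IsDecomposition (ρ : H →L[ℂ] H) (φ : ℕ → H) : Prop :=
  HasSum (fun i => InnerProductSpace.rankOne ℂ (φ i) (φ i)) ρ

end TraceClass

namespace PosOp

variable (G : PosOp H)

/-- `Tr G ρ ∈ [0, ∞]` for a positive trace class operator `ρ`, defined as `supₙ Tr Pₙ G ρ`, where
`Pₙ` is the spectral projector of `G` for `[0, n]`. -/
noncomputable def energy (ρ : H →L[ℂ] H) : ℝ≥0∞ :=
  ⨆ n : ℕ, ENNReal.ofReal (trace (G.truncation n ∘ₗ ρ.toLinearMap)).re

/-- The cone of positive trace class operators `ρ` with `Tr G ρ < ∞`. -/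
def finiteEnergy : Set (H →L[ℂ] H) := {ρ | ρ ∈ traceClassPos H ∧ G.energy ρ < ∞}

/-- The set of positive trace class operators `ρ` with `Tr ρ ≤ 1` and `Tr G ρ ≤ E`. -/
def energyBall (E : ℝ) : Set (H →L[ℂ] H) :=
  {ρ | ρ ∈ traceClassPos H ∧ (trace ρ.toLinearMap).re ≤ 1 ∧ G.energy ρ ≤ ENNReal.ofReal E}

/-- `(a, b)` is a pair of nonnegative numbers with `‖A φ‖² ≤ a² ‖φ‖² + b² ‖√G φ‖²` for all `φ` in
the domain of `√G`. -/
def IsBoundPair (A : G.sqrt.domain →ₗ[ℂ] H) (a b : ℝ) : Prop :=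
  0 ≤ a ∧ 0 ≤ b ∧
    ∀ φ : G.sqrt.domain, ‖A φ‖ ^ 2 ≤ a ^ 2 * ‖(φ : H)‖ ^ 2 + b ^ 2 * ‖G.sqrt φ‖ ^ 2

/-- The linear operator `A`, defined on the domain of `√G`, is `√G`-bounded. -/
def IsSqrtBounded (A : G.sqrt.domain →ₗ[ℂ] H) : Prop := ∃ a b : ℝ, G.IsBoundPair A a b

/-- The `√G`-bound of `A`. -/
noncomputable def relBound (A : G.sqrt.domain →ₗ[ℂ] H) : ℝ := sInf {b | ∃ a, G.IsBoundPair A a b}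

/-- The `√G`-bounded operator `A` is `√G`-infinitesimal: its `√G`-bound is zero. -/
def IsSqrtInfinitesimal (A : G.sqrt.domain →ₗ[ℂ] H) : Prop :=
  G.IsSqrtBounded A ∧ G.relBound A = 0

/-- The operator `E`-norm: the supremum of `‖A φ‖` over all unit vectors `φ` in the domain of `√G`
with `‖√G φ‖² ≤ E`. -/
noncomputable def eNorm (A : G.sqrt.domain →ₗ[ℂ] H) (E : ℝ) : ℝ≥0∞ :=
  ⨆ φ : {φ : G.sqrt.domain // ‖(φ : H)‖ = 1 ∧ ‖G.sqrt φ‖ ^ 2 ≤ E}, ‖A φ.1‖ₑ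

/-- `T` is the value of `A ρ B*`: for every decomposition `ρ = ∑ᵢ |φᵢ⟩⟨φᵢ|` all the vectors `φᵢ` lie
in the domain of `√G`, and `T = ∑ᵢ |A φᵢ⟩⟨B φᵢ|`. -/
def IsSandwich (A B : G.sqrt.domain →ₗ[ℂ] H) (ρ T : H →L[ℂ] H) : Prop :=
  ∀ φ : ℕ → H, IsDecomposition ρ φ → ∃ hφ : ∀ i, φ i ∈ G.sqrt.domain,
    HasSum (fun i => InnerProductSpace.rankOne ℂ (A ⟨φ i, hφ i⟩) (B ⟨φ i, hφ i⟩)) T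

open Classical in
/-- The operator `A ρ B*` (zero if the defining sums do not give a common value). -/
noncomputable def sandwich (A B : G.sqrt.domain →ₗ[ℂ] H) (ρ : H →L[ℂ] H) : H →L[ℂ] H :=
  if h : ∃ T, G.IsSandwich A B ρ T then h.choose else 0

end PosOp

end OpENorm

set_option linter.unusedSectionVars false

universe u

namespace OpENorm

/-! ### Cauchy–Schwarz, Parseval and Hilbert–Schmidt sums -/

variable {H : Type*} [NormedAddCommGroup H] [InnerProductSpace ℂ H]

/-! Fix one Hilbert basis `e` and put `xᵢ = √ρ eᵢ`, `yᵢ = √σ eᵢ`. Then `A ρ B* - A σ B* = ∑ |A(xᵢ -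
yᵢ)⟩⟨B xᵢ| + ∑ |A yᵢ⟩⟨B(xᵢ - yᵢ)|`, and by Cauchy–Schwarz the trace norm is controlled by sums such
as `∑ ‖A(xᵢ - yᵢ)‖²` and `∑ ‖B xᵢ‖²`. The Powers–Størmer inequality (`tsum_enorm_sqrt_sub_sq_le`)
gives `∑ ‖xᵢ - yᵢ‖² ≤ ‖ρ - σ‖₁ ≤ ε`, while the parallelogram law gives `∑ ‖√G(xᵢ - yᵢ)‖² ≤ 4E = ε ·
(4E/ε)`.

It remains to bound `∑ ‖A φₖ‖²` by `s (‖A‖ᴳ_E)²` for families of mass at most `s` and energy at most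
`sE`, although the `E`-norm only tests single vectors. The S-lemma (`exists_multiplier`) yields
`‖Aφ‖² ≤ m‖φ‖² + c‖√Gφ‖²` with `m + cE = (‖A‖ᴳ_E)²`, an inequality that can be summed. The infimum
`0` of `‖Gφ‖` over unit vectors supplies the strictly feasible vector and forces `m ≥ 0`.

For the limit, `√ε ‖A‖ᴳ_{4E/ε} ≤ a√ε + 2b√E` for every bound pair `(a, b)`, and `b` may be taken
small. Conversely, if `A` has positive `√G`-bound, there are vectors of energy exactly `E` and
arbitrarily small norm with `‖Aφ‖²` bounded below. The corresponding rank-one operators break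
continuity at `0`.

`A ρ B*` does not depend on the decomposition because it is the weak limit of `(A Pₙ) ρ (B Pₙ)*`,
where `A Pₙ` and `B Pₙ` are bounded. -/

theorem tsum_mul_le_of_tsum_sq_le {ι : Type*} {f g : ι → ℝ≥0∞} {α β : ℝ≥0∞}
    (hf : ∑' i, f i ^ 2 ≤ α ^ 2) (hg : ∑' i, g i ^ 2 ≤ β ^ 2) : ∑' i, f i * g i ≤ α * β := by
  rw [ENNReal.tsum_eq_iSup_sum]
  refine iSup_le fun s => ?_
  have h := ENNReal.inner_le_Lp_mul_Lq s f g Real.HolderConjugate.two_two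
  have key : ∀ {f : ι → ℝ≥0∞} {α : ℝ≥0∞}, ∑' i, f i ^ 2 ≤ α ^ 2 →
      (∑ i ∈ s, f i ^ (2 : ℝ)) ^ (1 / 2 : ℝ) ≤ α := by
    intro f α hf
    have h1 : ∑ i ∈ s, f i ^ (2 : ℝ) ≤ α ^ (2 : ℝ) := by
      simp only [ENNReal.rpow_two]
      exact (ENNReal.sum_le_tsum s).trans hf
    calc (∑ i ∈ s, f i ^ (2 : ℝ)) ^ (1 / 2 : ℝ) ≤ (α ^ (2 : ℝ)) ^ (1 / 2 : ℝ) :=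
          ENNReal.rpow_le_rpow h1 (by norm_num)
      _ = α := by rw [← ENNReal.rpow_mul]; norm_num
  exact h.trans (mul_le_mul' (key hf) (key hg))

theorem enorm_sq_eq_ofReal (x : H) : ‖x‖ₑ ^ 2 = ENNReal.ofReal (‖x‖ ^ 2) := by
  rw [← ofReal_norm, ENNReal.ofReal_pow (norm_nonneg _)]

/-- Parseval's identity. -/
theorem tsum_enorm_inner_sq {ι : Type*} (e : HilbertBasis ι ℂ H) (x : H) :
    ∑' i, ‖inner ℂ (e i) x‖ₑ ^ 2 = ‖x‖ₑ ^ 2 := by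
  have h := e.hasSum_inner_mul_inner x x
  have h1 : HasSum (fun i => ‖inner ℂ (e i) x‖ ^ 2) (‖x‖ ^ 2) := by
    have h2 := Complex.hasSum_re h
    rw [show (inner ℂ x x).re = ‖x‖ ^ 2 from inner_self_eq_norm_sq (𝕜 := ℂ) x] at h2
    convert h2 using 2 with i
    rw [← inner_conj_symm x, Complex.conj_mul', ← Complex.ofReal_pow, Complex.ofReal_re]
  simp only [enorm_sq_eq_ofReal]
  rw [← ENNReal.ofReal_tsum_of_nonneg (fun _ => by positivity) h1.summable, h1.tsum_eq]

theorem tsum_enorm_inner_sq' {ι : Type*} (e : HilbertBasis ι ℂ H) (x : H) :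
    ∑' i, ‖inner ℂ x (e i)‖ₑ ^ 2 = ‖x‖ₑ ^ 2 := by
  rw [← tsum_enorm_inner_sq e x]
  refine tsum_congr fun i => ?_
  rw [← inner_conj_symm, RCLike.enorm_conj]

theorem tsum_enorm_inner_mul_inner_le {ι : Type*} (e : HilbertBasis ι ℂ H) (x y : H) :
    ∑' i, ‖inner ℂ (e i) x‖ₑ * ‖inner ℂ y (e i)‖ₑ ≤ ‖x‖ₑ * ‖y‖ₑ :=
  tsum_mul_le_of_tsum_sq_le (tsum_enorm_inner_sq e x).le (tsum_enorm_inner_sq' e y).le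

theorem summable_norm_of_tsum_enorm_ne_top {ι F : Type*} [NormedAddCommGroup F] {f : ι → F}
    (h : ∑' i, ‖f i‖ₑ ≠ ∞) : Summable fun i => ‖f i‖ := by
  have h1 := ENNReal.summable_toReal h
  simpa using h1

/-- The Hilbert-Schmidt norm of a symmetric operator does not depend on the basis. -/
theorem tsum_enorm_sq_basis_eq {ι κ : Type*} (e : HilbertBasis ι ℂ H) (f : HilbertBasis κ ℂ H)
    {S : H →L[ℂ] H} (hS : S.IsSymmetric) : ∑' i, ‖S (e i)‖ₑ ^ 2 = ∑' j, ‖S (f j)‖ₑ ^ 2 := by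
  calc ∑' i, ‖S (e i)‖ₑ ^ 2 = ∑' i, ∑' j, ‖inner ℂ (f j) (S (e i))‖ₑ ^ 2 := by
        simp only [tsum_enorm_inner_sq]
    _ = ∑' j, ∑' i, ‖inner ℂ (f j) (S (e i))‖ₑ ^ 2 := ENNReal.tsum_comm
    _ = ∑' j, ∑' i, ‖inner ℂ (S (f j)) (e i)‖ₑ ^ 2 := by
        refine tsum_congr fun j => tsum_congr fun i => ?_
        rw [show inner ℂ (S (f j)) (e i) = inner ℂ (f j) (S (e i)) from hS _ _]
    _ = ∑' j, ‖S (f j)‖ₑ ^ 2 := by simp only [tsum_enorm_inner_sq']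

/-! ### Sums of rank-one operators -/

/-- `T = ∑ₖ |aₖ⟩⟨bₖ|` in the weak sense. -/
def IsWeakSum {ι : Type*} (T : H →L[ℂ] H) (a b : ι → H) : Prop :=
  ∀ u v, HasSum (fun k => inner ℂ u (a k) * inner ℂ (b k) v) (inner ℂ u (T v))

theorem isWeakSum_of_hasSum {ι : Type*} {T : H →L[ℂ] H} {a b : ι → H}
    (h : HasSum (fun k => InnerProductSpace.rankOne ℂ (a k) (b k)) T) : IsWeakSum T a b := by
  intro u v
  have h1 := ((innerSL ℂ u).comp (ContinuousLinearMap.apply ℂ H v)).hasSum h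
  simpa [Function.comp_def, inner_smul_right, mul_comm] using h1

theorem IsWeakSum.unique {ι : Type*} {T S : H →L[ℂ] H} {a b : ι → H} (hT : IsWeakSum T a b)
    (hS : IsWeakSum S a b) : T = S := by
  ext v
  exact ext_inner_left ℂ fun u => (hT u v).unique (hS u v)

theorem enorm_rankOne (x y : H) : ‖InnerProductSpace.rankOne ℂ x y‖ₑ = ‖x‖ₑ * ‖y‖ₑ := by
  rw [← ofReal_norm, InnerProductSpace.norm_rankOne, ENNReal.ofReal_mul (norm_nonneg _),
    ofReal_norm, ofReal_norm]

variable [CompleteSpace H]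

theorem exists_hasSum_rankOne {ι : Type*} {a b : ι → H} (h : ∑' k, ‖a k‖ₑ * ‖b k‖ₑ ≠ ∞) :
    ∃ T : H →L[ℂ] H, HasSum (fun k => InnerProductSpace.rankOne ℂ (a k) (b k)) T := by
  have h1 : Summable fun k => InnerProductSpace.rankOne ℂ (a k) (b k) := by
    refine Summable.of_norm (summable_norm_of_tsum_enorm_ne_top ?_)
    simpa only [enorm_rankOne] using h
  exact ⟨_, h1.hasSum⟩

/-- The series converges absolutely in operator norm, and its norm limit is the only operator with
the given matrix elements. Decompositions and sandwiches are defined by norm convergence, so this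
upgrade is needed. -/
theorem IsWeakSum.hasSum {ι : Type*} {T : H →L[ℂ] H} {a b : ι → H} (hT : IsWeakSum T a b)
    (h : ∑' k, ‖a k‖ₑ * ‖b k‖ₑ ≠ ∞) :
    HasSum (fun k => InnerProductSpace.rankOne ℂ (a k) (b k)) T := by
  obtain ⟨S, hS⟩ := exists_hasSum_rankOne h
  rwa [hT.unique (isWeakSum_of_hasSum hS)]

theorem IsWeakSum.map {ι : Type*} {T : H →L[ℂ] H} {a b : ι → H} (hT : IsWeakSum T a b)
    (K L : H →L[ℂ] H) : IsWeakSum (K ∘L T ∘L L.adjoint) (fun k => K (a k)) (fun k => L (b k)) := by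
  intro u v
  have h := hT (K.adjoint u) (L.adjoint v)
  simpa only [ContinuousLinearMap.adjoint_inner_left, ContinuousLinearMap.adjoint_inner_right,
    ContinuousLinearMap.comp_apply] using h

/-! ### Trace norm and trace of a sum of rank-one operators -/

/-- For every operator `T` the form of `|T|` is approximated by `⟨V x, T x⟩` with contractions
`V`, uniformly on the unit ball. -/
theorem exists_contraction_abs_le (T : H →L[ℂ] H) {δ : ℝ} (hδ : 0 < δ) :
    ∃ V : H →L[ℂ] H, ‖V‖ ≤ 1 ∧ ∀ x, (inner ℂ x (CFC.abs T x)).re ≤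
      ‖inner ℂ (V x) (T x)‖ + δ * ‖x‖ ^ 2 := by
  set M := CFC.abs T with hM
  have hM0 : 0 ≤ M := CFC.abs_nonneg T
  have hMp := (ContinuousLinearMap.nonneg_iff_isPositive _).1 hM0
  have hMM : ∀ x y, inner ℂ (M x) (M y) = inner ℂ (T x) (T y) := by
    intro x y
    have h1 : M * M = star T * T := CFC.abs_mul_abs T
    have h2 : M (M y) = T.adjoint (T y) := congrArg (fun A : H →L[ℂ] H => A y) h1
    rw [show inner ℂ (M x) (M y) = inner ℂ x (M (M y)) from hMp.isSymmetric _ _, h2,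
      ContinuousLinearMap.adjoint_inner_right]
  have hnorm : ∀ x, ‖M x‖ = ‖T x‖ := by
    intro x
    have h1 := congrArg Complex.re (hMM x x)
    rw [show (inner ℂ (M x) (M x)).re = ‖M x‖ ^ 2 from inner_self_eq_norm_sq (𝕜 := ℂ) _,
      show (inner ℂ (T x) (T x)).re = ‖T x‖ ^ 2 from inner_self_eq_norm_sq (𝕜 := ℂ) _] at h1
    exact (sq_eq_sq₀ (norm_nonneg _) (norm_nonneg _)).1 h1
  -- With `W = (δ + |T|)⁻¹`, the operator `V = T W` stands in for the partial isometry of the polar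
  -- decomposition.
  have hB : IsUnit (algebraMap ℝ (H →L[ℂ] H) δ + M) := by
    have hs : IsStrictlyPositive (algebraMap ℝ (H →L[ℂ] H) δ) :=
      (IsStrictlyPositive.iff_of_unital).2
        ⟨algebraMap_nonneg _ hδ.le, (IsUnit.mk0 δ hδ.ne').map _⟩
    exact (hs.add_nonneg hM0).isUnit
  obtain ⟨B, hB⟩ := hB
  have hBx : ∀ z, (B : H →L[ℂ] H) z = (δ : ℂ) • z + M z := by
    intro z
    rw [hB, Algebra.algebraMap_eq_smul_one, Complex.coe_smul]
    rfl
  set W : H →L[ℂ] H := ↑B⁻¹ with hW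
  have hWx : ∀ x, (δ : ℂ) • W x + M (W x) = x := by
    intro x
    rw [← hBx]
    exact congrArg (fun A : H →L[ℂ] H => A x) B.mul_inv
  -- In `x = δ W x + M W x` the two summands have a nonnegative real inner product, since `M ≥ 0`.
  have hle : ∀ x, ‖M (W x)‖ ≤ ‖x‖ := by
    intro x
    have h1 := norm_add_sq (𝕜 := ℂ) ((δ : ℂ) • W x) (M (W x))
    rw [hWx] at h1
    have h2 : 0 ≤ RCLike.re (inner ℂ ((δ : ℂ) • W x) (M (W x))) := by
      rw [inner_smul_left, Complex.conj_ofReal]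
      change 0 ≤ (((δ : ℂ) * inner ℂ (W x) (M (W x))).re)
      rw [Complex.re_ofReal_mul]
      exact mul_nonneg hδ.le (hMp.re_inner_nonneg_right _)
    refine abs_le_of_sq_le_sq' ?_ (norm_nonneg _) |>.2
    rw [h1]
    nlinarith [sq_nonneg ‖(δ : ℂ) • W x‖]
  refine ⟨T ∘L W, ?_, fun x => ?_⟩
  · refine ContinuousLinearMap.opNorm_le_bound _ zero_le_one fun x => ?_
    rw [one_mul, ContinuousLinearMap.comp_apply, ← hnorm]
    exact hle x
  · have h1 : inner ℂ x (M x) = inner ℂ (T (W x)) (T x) + δ * inner ℂ (M (W x)) x := by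
      nth_rewrite 1 [← hWx x]
      rw [inner_add_left, hMM, inner_smul_left, Complex.conj_ofReal,
        show inner ℂ (M (W x)) x = inner ℂ (W x) (M x) from hMp.isSymmetric _ _]
      ring
    rw [h1, Complex.add_re, Complex.re_ofReal_mul]
    refine add_le_add (Complex.re_le_norm _) (mul_le_mul_of_nonneg_left ?_ hδ.le)
    refine (Complex.re_le_norm _).trans ((norm_inner_le_norm _ _).trans ?_)
    nlinarith [hle x, norm_nonneg x]

/-- The trace norm of `∑ₖ |aₖ⟩⟨bₖ|` is at most `∑ₖ ‖aₖ‖ ‖bₖ‖`. -/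
theorem IsWeakSum.traceNorm_le {ι : Type*} {T : H →L[ℂ] H} {a b : ι → H}
    (hT : IsWeakSum T a b) : traceNorm T ≤ ∑' k, ‖a k‖ₑ * ‖b k‖ₑ := by
  set e := basis H
  rw [traceNorm, ENNReal.tsum_eq_iSup_sum]
  refine iSup_le fun s => ?_
  refine ENNReal.le_of_forall_pos_le_add fun δ hδ _ => ?_
  -- The error `δ'` is paid once for each basis vector in `s`, in total at most `δ`; the `+ 1`
  -- covers the empty set.
  set δ' : ℝ := δ / (s.card + 1) with hδ'
  have hδ'0 : 0 < δ' := by positivity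
  obtain ⟨V, hV, hVT⟩ := exists_contraction_abs_le T hδ'0
  have h1 : ∀ i, ENNReal.ofReal (inner ℂ (e i) (CFC.abs T (e i))).re ≤
      (∑' k, ‖inner ℂ (V (e i)) (a k)‖ₑ * ‖inner ℂ (b k) (e i)‖ₑ) + ENNReal.ofReal δ' := by
    intro i
    have h2 := hVT (e i)
    rw [e.orthonormal.1 i, one_pow, mul_one] at h2
    refine (ENNReal.ofReal_le_ofReal h2).trans ?_
    rw [ENNReal.ofReal_add (norm_nonneg _) hδ'0.le, ofReal_norm]
    gcongr
    rw [← (hT (V (e i)) (e i)).tsum_eq]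
    refine enorm_tsum_le_tsum_enorm.trans (le_of_eq ?_)
    simp only [enorm_mul]
  calc ∑ i ∈ s, ENNReal.ofReal (inner ℂ (e i) (CFC.abs T (e i))).re
      ≤ ∑ i ∈ s, ((∑' k, ‖inner ℂ (V (e i)) (a k)‖ₑ * ‖inner ℂ (b k) (e i)‖ₑ)
          + ENNReal.ofReal δ') := Finset.sum_le_sum fun i _ => h1 i
    _ = (∑ i ∈ s, ∑' k, ‖inner ℂ (V (e i)) (a k)‖ₑ * ‖inner ℂ (b k) (e i)‖ₑ)
          + s.card * ENNReal.ofReal δ' := by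
        rw [Finset.sum_add_distrib, Finset.sum_const, nsmul_eq_mul]
    _ ≤ (∑' i, ∑' k, ‖inner ℂ (V (e i)) (a k)‖ₑ * ‖inner ℂ (b k) (e i)‖ₑ) + δ := by
        refine add_le_add (ENNReal.sum_le_tsum _) ?_
        rw [← ENNReal.ofReal_natCast, ← ENNReal.ofReal_mul (by positivity),
          ← ENNReal.ofReal_coe_nnreal]
        refine ENNReal.ofReal_le_ofReal ?_
        rw [hδ', mul_div_assoc', div_le_iff₀ (by positivity)]
        nlinarith [δ.coe_nonneg]
    -- Moving `V` onto `aₖ` and exchanging the sums leaves, for each `k`, a Cauchy–Schwarz estimate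
    -- over the basis.
    _ = (∑' k, ∑' i, ‖inner ℂ (e i) (V.adjoint (a k))‖ₑ * ‖inner ℂ (b k) (e i)‖ₑ) + δ := by
        rw [ENNReal.tsum_comm]
        simp only [ContinuousLinearMap.adjoint_inner_right]
    _ ≤ (∑' k, ‖a k‖ₑ * ‖b k‖ₑ) + δ := by
        gcongr with k
        refine (tsum_enorm_inner_mul_inner_le e _ _).trans ?_
        gcongr
        rw [enorm_le_iff_norm_le]
        refine (V.adjoint.le_opNorm _).trans ?_
        rw [LinearIsometryEquiv.norm_map]
        exact mul_le_of_le_one_left (norm_nonneg _) hV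

theorem traceNorm_of_isPositive {ρ : H →L[ℂ] H} (hρ : ρ.IsPositive) :
    traceNorm ρ = ∑' i, ENNReal.ofReal (inner ℂ (basis H i) (ρ (basis H i))).re := by
  rw [traceNorm, CFC.abs_of_nonneg ρ ((ContinuousLinearMap.nonneg_iff_isPositive _).2 hρ)]

theorem IsWeakSum.hasSum_re_inner {ι : Type*} {ρ : H →L[ℂ] H} {φ : ι → H} (h : IsWeakSum ρ φ φ)
    (x : H) : HasSum (fun k => ‖inner ℂ x (φ k)‖ ^ 2) (inner ℂ x (ρ x)).re := by
  have h2 := Complex.hasSum_re (h x x)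
  convert h2 using 2 with k
  rw [← inner_conj_symm (φ k), Complex.mul_conj', ← Complex.ofReal_pow, Complex.ofReal_re]

theorem IsWeakSum.ofReal_inner {ι : Type*} {ρ : H →L[ℂ] H} {φ : ι → H} (h : IsWeakSum ρ φ φ)
    (x : H) : ENNReal.ofReal (inner ℂ x (ρ x)).re = ∑' k, ‖inner ℂ x (φ k)‖ₑ ^ 2 := by
  have h1 := h.hasSum_re_inner x
  simp only [enorm_sq_eq_ofReal]
  rw [← ENNReal.ofReal_tsum_of_nonneg (fun _ => by positivity) h1.summable, h1.tsum_eq]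

theorem IsWeakSum.isPositive {ι : Type*} {ρ : H →L[ℂ] H} {φ : ι → H} (h : IsWeakSum ρ φ φ) :
    ρ.IsPositive := by
  refine ⟨fun x y => ?_, fun x => ?_⟩
  · rw [ContinuousLinearMap.coe_coe, ← inner_conj_symm]
    refine ((h y x).map (starRingEnd ℂ) Complex.continuous_conj).unique ?_
    convert h x y using 2 with k
    rw [Function.comp_apply, map_mul, inner_conj_symm, inner_conj_symm, mul_comm]
  · change 0 ≤ (inner ℂ (ρ x) x).re
    rw [show (inner ℂ (ρ x) x).re = (inner ℂ x (ρ x)).re from inner_re_symm (𝕜 := ℂ) _ _]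
    exact (h.hasSum_re_inner x).nonneg fun _ => by positivity

/-- Here `|ρ| = ρ`, so both sides are the double sum of `|⟨eᵢ, φₖ⟩|²`, taken in different orders.
Every decomposition therefore has the same mass, finite or not. -/
theorem IsWeakSum.traceNorm_eq {ι : Type*} {ρ : H →L[ℂ] H} {φ : ι → H} (h : IsWeakSum ρ φ φ) :
    traceNorm ρ = ∑' k, ‖φ k‖ₑ ^ 2 := by
  rw [traceNorm_of_isPositive h.isPositive]
  simp only [h.ofReal_inner]
  rw [ENNReal.tsum_comm]
  simp only [tsum_enorm_inner_sq]

/-- Fubini for the absolutely summable family `F`: summing over `k` first gives the diagonal entries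
of `K T`, summing over `i` first gives `⟨bₖ, K aₖ⟩` by Parseval. -/
theorem IsWeakSum.trace_comp {ι : Type*} {T : H →L[ℂ] H} {a b : ι → H} (h : IsWeakSum T a b)
    (hs : ∑' k, ‖a k‖ₑ * ‖b k‖ₑ ≠ ∞) (K : H →L[ℂ] H) :
    HasSum (fun k => inner ℂ (b k) (K (a k))) (trace (K.toLinearMap ∘ₗ T.toLinearMap)) := by
  set e := basis H
  set F : basisIndex H × ι → ℂ := fun p =>
    inner ℂ (e p.1) (K (a p.2)) * inner ℂ (b p.2) (e p.1) with hF
  have hle : ∑' p, ‖F p‖ₑ ≠ ∞ := by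
    refine ne_top_of_le_ne_top (b := ‖K‖ₑ * ∑' k, ‖a k‖ₑ * ‖b k‖ₑ)
      (ENNReal.mul_ne_top enorm_ne_top hs) ?_
    rw [ENNReal.tsum_prod', ENNReal.tsum_comm, ← ENNReal.tsum_mul_left]
    refine ENNReal.tsum_le_tsum fun k => ?_
    simp only [hF, enorm_mul]
    refine (tsum_enorm_inner_mul_inner_le e _ _).trans ?_
    rw [← mul_assoc]
    gcongr
    exact K.le_opENorm _
  have hsum : Summable F := Summable.of_norm (summable_norm_of_tsum_enorm_ne_top hle)
  have h1 : ∀ i, HasSum (fun k => F (i, k)) (inner ℂ (e i) (K (T (e i)))) := fun i => by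
    have h2 := h (K.adjoint (e i)) (e i)
    simpa only [ContinuousLinearMap.adjoint_inner_left] using h2
  have h2 : ∀ k, HasSum (fun i => F (i, k)) (inner ℂ (b k) (K (a k))) := fun k => by
    have := e.hasSum_inner_mul_inner (b k) (K (a k))
    simpa only [hF, mul_comm] using this
  have h3 := hsum.hasSum.prod_fiberwise h1
  have h4 := ((Equiv.prodComm ι (basisIndex H)).hasSum_iff.2 hsum.hasSum).prod_fiberwise h2
  rw [trace]
  convert h4 using 1
  exact h3.tsum_eq

/-! ### Square roots of trace class operators and the Powers–Størmer inequality -/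

theorem enorm_sub_sq_le (x y : H) : ‖x - y‖ₑ ^ 2 ≤ 2 * (‖x‖ₑ ^ 2 + ‖y‖ₑ ^ 2) := by
  have h := parallelogram_law_with_norm ℂ x y
  simp only [enorm_sq_eq_ofReal]
  rw [← ENNReal.ofReal_add (by positivity) (by positivity), ← ENNReal.ofReal_ofNat,
    ← ENNReal.ofReal_mul (by norm_num)]
  refine ENNReal.ofReal_le_ofReal ?_
  nlinarith [mul_self_nonneg ‖x + y‖]

/-- If `f` is an eigenvector of `P - Q` for positive `P` and `Q`, then
`‖(P - Q) f‖² ≤ |‖P f‖² - ‖Q f‖²|`. -/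
theorem norm_sub_sq_le_abs_of_eigenvector {P Q : H →L[ℂ] H} (hP : P.IsPositive)
    (hQ : Q.IsPositive) {f : H} (hf : ‖f‖ = 1) {c : ℂ} (hc : P f - Q f = c • f) :
    ‖P f - Q f‖ ^ 2 ≤ |‖P f‖ ^ 2 - ‖Q f‖ ^ 2| := by
  have hs : 0 ≤ (inner ℂ f (P f)).re := hP.re_inner_nonneg_right f
  have ht : 0 ≤ (inner ℂ f (Q f)).re := hQ.re_inner_nonneg_right f
  have hs' : ((inner ℂ f (P f)).re : ℂ) = inner ℂ f (P f) := by
    rw [show inner ℂ f (P f) = inner ℂ (P f) f from (hP.isSymmetric f f).symm]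
    exact hP.isSymmetric.coe_re_inner_apply_self f
  have ht' : ((inner ℂ f (Q f)).re : ℂ) = inner ℂ f (Q f) := by
    rw [show inner ℂ f (Q f) = inner ℂ (Q f) f from (hQ.isSymmetric f f).symm]
    exact hQ.isSymmetric.coe_re_inner_apply_self f
  set s := (inner ℂ f (P f)).re with hsdef
  set t := (inner ℂ f (Q f)).re with htdef
  have hff : inner ℂ f f = (1 : ℂ) := by
    rw [inner_self_eq_norm_sq_to_K, hf]; simp
  have hcst : c = ((s - t : ℝ) : ℂ) := by
    have h1 := congrArg (inner ℂ f) hc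
    rw [inner_sub_right, inner_smul_right, hff, mul_one, ← hs', ← ht'] at h1
    rw [← h1, Complex.ofReal_sub]
  -- The difference is `Re ⟨(P - Q) f, (P + Q) f⟩`, and `(P - Q) f = (s - t) f`. Since `s, t ≥ 0`,
  -- `|s - t| ≤ s + t`, which ends the proof.
  have h2 : ‖P f‖ ^ 2 - ‖Q f‖ ^ 2 = (s - t) * (s + t) := by
    have h3 : (inner ℂ (P f - Q f) (P f + Q f)).re = ‖P f‖ ^ 2 - ‖Q f‖ ^ 2 := by
      have h4 : (inner ℂ (Q f) (P f)).re = (inner ℂ (P f) (Q f)).re :=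
        inner_re_symm (𝕜 := ℂ) _ _
      have h5 : ∀ z : H, (inner ℂ z z).re = ‖z‖ ^ 2 := fun z => inner_self_eq_norm_sq (𝕜 := ℂ) z
      rw [inner_sub_left, inner_add_right, inner_add_right, Complex.sub_re, Complex.add_re,
        Complex.add_re, h5, h5, h4]
      ring
    rw [← h3, hc, hcst, inner_smul_left, Complex.conj_ofReal, Complex.re_ofReal_mul,
      inner_add_right, Complex.add_re]
  rw [hc, norm_smul, hf, mul_one, h2, hcst, Complex.norm_real, Real.norm_eq_abs, abs_mul, sq]
  refine mul_le_mul_of_nonneg_left ?_ (abs_nonneg _)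
  rw [abs_le, abs_of_nonneg (add_nonneg hs ht)]
  constructor <;> linarith

theorem sqrt_isPositive (ρ : H →L[ℂ] H) : (CFC.sqrt ρ).IsPositive :=
  (ContinuousLinearMap.nonneg_iff_isPositive _).1 (CFC.sqrt_nonneg _)

theorem inner_sqrt_sqrt {ρ : H →L[ℂ] H} (hρ : ρ.IsPositive) (x y : H) :
    inner ℂ (CFC.sqrt ρ x) (CFC.sqrt ρ y) = inner ℂ x (ρ y) := by
  have h : CFC.sqrt ρ (CFC.sqrt ρ y) = ρ y := congrArg (fun T : H →L[ℂ] H => T y)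
    (CFC.sqrt_mul_sqrt_self _ ((ContinuousLinearMap.nonneg_iff_isPositive _).2 hρ))
  rw [← h]
  exact (sqrt_isPositive ρ).isSymmetric x _

theorem norm_sqrt_sq {ρ : H →L[ℂ] H} (hρ : ρ.IsPositive) (x : H) :
    ‖CFC.sqrt ρ x‖ ^ 2 = (inner ℂ x (ρ x)).re := by
  rw [← inner_sqrt_sqrt hρ]
  exact (inner_self_eq_norm_sq (𝕜 := ℂ) _).symm

/-- A positive operator is `∑ᵢ |√ρ eᵢ⟩⟨√ρ eᵢ|` for every Hilbert basis `e`. -/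
theorem isWeakSum_sqrt {ι : Type*} (e : HilbertBasis ι ℂ H) {ρ : H →L[ℂ] H}
    (hρ : ρ.IsPositive) :
    IsWeakSum ρ (fun i => CFC.sqrt ρ (e i)) (fun i => CFC.sqrt ρ (e i)) := by
  intro u v
  have h := e.hasSum_inner_mul_inner (CFC.sqrt ρ u) (CFC.sqrt ρ v)
  rw [inner_sqrt_sqrt hρ] at h
  have h1 : ∀ x y, inner ℂ (CFC.sqrt ρ x) y = inner ℂ x (CFC.sqrt ρ y) :=
    (sqrt_isPositive ρ).isSymmetric
  simpa only [h1] using h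

theorem tsum_sqrt_basis {ι : Type*} (e : HilbertBasis ι ℂ H) {ρ : H →L[ℂ] H}
    (hρ : ρ.IsPositive) : ∑' i, ‖CFC.sqrt ρ (e i)‖ₑ ^ 2 = traceNorm ρ :=
  (isWeakSum_sqrt e hρ).traceNorm_eq.symm

/-- Orthonormal vectors lie at distance `√2`, so the balls of radius `1/2` around them are disjoint
open sets in a separable space. -/
theorem countable_basisIndex (H : Type*) [NormedAddCommGroup H] [InnerProductSpace ℂ H]
    [CompleteSpace H] [TopologicalSpace.SeparableSpace H] : Countable (basisIndex H) := by
  set e := basis H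
  refine Pairwise.countable_of_isOpen_disjoint (s := fun i => Metric.ball (e i) (1 / 2))
    (fun i j hij => ?_) (fun i => Metric.isOpen_ball) fun i => ⟨e i, by simp⟩
  refine Metric.ball_disjoint_ball ?_
  have h1 := norm_sub_sq (𝕜 := ℂ) (e i) (e j)
  rw [e.orthonormal.2 hij, e.orthonormal.1, e.orthonormal.1] at h1
  rw [dist_eq_norm]
  refine abs_le_of_sq_le_sq' ?_ (norm_nonneg _) |>.2
  rw [h1]
  norm_num

theorem exists_isDecomposition [TopologicalSpace.SeparableSpace H] {ρ : H →L[ℂ] H}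
    (hρ : ρ ∈ traceClassPos H) : ∃ φ : ℕ → H, IsDecomposition ρ φ := by
  have := countable_basisIndex H
  obtain ⟨f, hf⟩ := exists_injective_nat (basisIndex H)
  have h1 := isWeakSum_sqrt (basis H) hρ.1
  have h2 := h1.hasSum (by
    simp only [← sq]
    rw [tsum_sqrt_basis _ hρ.1]
    exact hρ.2)
  -- Zero vectors fill the indices outside the range of `f`, which covers finite bases as well.
  refine ⟨Function.extend f (fun i => CFC.sqrt ρ (basis H i)) 0, ?_⟩
  rw [IsDecomposition, ← hf.hasSum_iff]
  · convert h2 using 2 with i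
    simp [hf.extend_apply]
  · intro n hn
    rw [Function.extend_apply' _ _ _ (by simpa using hn)]
    simp

theorem enorm_sq_le_tsum_basis {ι : Type*} (e : HilbertBasis ι ℂ H) (D : H →L[ℂ] H) :
    ‖D‖ₑ ^ 2 ≤ ∑' i, ‖D (e i)‖ₑ ^ 2 := by
  set β : ℝ≥0∞ := (∑' i, ‖D (e i)‖ₑ ^ 2) ^ (1 / 2 : ℝ) with hβ
  have hβ2 : β ^ 2 = ∑' i, ‖D (e i)‖ₑ ^ 2 := by
    rw [hβ, ← ENNReal.rpow_two, ← ENNReal.rpow_mul]; norm_num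
  rw [← hβ2]
  gcongr
  refine ContinuousLinearMap.opENorm_le_bound _ fun x => ?_
  have h1 := D.hasSum (e.hasSum_repr x)
  rw [← h1.tsum_eq, mul_comm]
  refine enorm_tsum_le_tsum_enorm.trans ?_
  simp only [map_smul, enorm_smul, e.repr_apply_apply]
  exact tsum_mul_le_of_tsum_sq_le (tsum_enorm_inner_sq e x).le hβ2.symm.le

/-- Hilbert-Schmidt operators are compact. -/
theorem isCompactOperator_of_tsum_ne_top {ι : Type*} (e : HilbertBasis ι ℂ H) {S : H →L[ℂ] H}
    (hS : ∑' i, ‖S (e i)‖ₑ ^ 2 ≠ ∞) : IsCompactOperator S := by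
  classical
  set F : Finset ι → H →L[ℂ] H := fun s =>
    ∑ i ∈ s, InnerProductSpace.rankOne ℂ (S (e i)) (e i) with hF
  have hF1 : ∀ s j, (F s - S) (e j) = if j ∈ s then 0 else - S (e j) := by
    intro s j
    have h1 : F s (e j) = if j ∈ s then S (e j) else 0 := by
      simp only [hF, _root_.sum_apply, InnerProductSpace.rankOne_apply,
        orthonormal_iff_ite.1 e.orthonormal, ite_smul, one_smul, zero_smul]
      rw [Finset.sum_ite_eq' s j]
    rw [_root_.sub_apply, h1]
    split_ifs <;> simp
  have hlim : Filter.Tendsto F Filter.atTop (nhds S) := by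
    rw [tendsto_iff_edist_tendsto_0]
    have h1 := ENNReal.tendsto_tsum_compl_atTop_zero hS
    -- `F s` is the finite rank truncation of `S`. The Hilbert–Schmidt norm dominates the operator
    -- norm, and that of `F s - S` is a tail of a convergent series.
    have h2 : ∀ s, edist (F s) S ^ 2 ≤ ∑' i : {i // i ∉ s}, ‖S (e i)‖ₑ ^ 2 := by
      intro s
      rw [edist_eq_enorm_sub]
      refine (enorm_sq_le_tsum_basis e _).trans (le_of_eq ?_)
      refine Eq.trans ?_ (tsum_subtype {i | i ∉ s} (fun i => ‖S (e i)‖ₑ ^ 2)).symm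
      refine tsum_congr fun j => ?_
      rw [hF1, Set.indicator_apply]
      by_cases hj : j ∈ s <;> simp [hj]
    have h3 : Filter.Tendsto (fun s => edist (F s) S ^ 2) Filter.atTop (nhds 0) :=
      tendsto_of_tendsto_of_tendsto_of_le_of_le tendsto_const_nhds h1 (fun _ => zero_le) h2
    have h4 := h3.ennrpow_const (1 / 2 : ℝ)
    simp only [← ENNReal.rpow_two, ← ENNReal.rpow_mul] at h4
    norm_num at h4
    exact h4
  refine isCompactOperator_of_tendsto hlim (Filter.Eventually.of_forall fun s => ?_)
  have h1 : F s ∈ compactOperator (RingHom.id ℂ) H H := by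
    refine Submodule.sum_mem _ fun i _ => ?_
    have h2 : IsCompactOperator (ContinuousLinearMap.toSpanSingleton ℂ (S (e i))) :=
      isCompactOperator_of_locallyCompactSpace_rng _
    exact h2.comp_clm (innerSL ℂ (e i))
  exact h1

/-- A compact symmetric operator has a Hilbert basis of eigenvectors. -/
theorem exists_hilbertBasis_eigenvectors {H : Type u} [NormedAddCommGroup H]
    [InnerProductSpace ℂ H] [CompleteSpace H] {S : H →L[ℂ] H} (hc : IsCompactOperator S)
    (hS : S.IsSymmetric) : ∃ (ι : Type u) (f : HilbertBasis ι ℂ H), ∀ j, ∃ c : ℂ,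
      S (f j) = c • f j := by
  have hcl : ∀ c : ℂ, IsClosed (Module.End.eigenspace (S : Module.End ℂ H) c : Set H) := by
    intro c
    have h1 : IsClosed {x : H | S x = c • x} :=
      isClosed_eq S.continuous (continuous_const_smul c)
    convert h1 using 1
    ext x
    exact Module.End.mem_eigenspace_iff
  have hcs : ∀ c : ℂ, CompleteSpace (Module.End.eigenspace (S : Module.End ℂ H) c) :=
    fun c => (hcl c).completeSpace_coe
  choose w b hb using fun c : ℂ =>
    exists_hilbertBasis ℂ (Module.End.eigenspace (S : Module.End ℂ H) c)
  have ho := hS.orthogonalFamily_eigenspaces.orthonormal_sigma_orthonormal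
    (fun c => (b c).orthonormal)
  refine ⟨_, HilbertBasis.mkOfOrthogonalEqBot ho ?_, fun j => ⟨j.1, ?_⟩⟩
  -- By the spectral theorem nothing nonzero is orthogonal to all eigenspaces, and each eigenspace
  -- is in the closed span of its own Hilbert basis.
  · rw [eq_bot_iff, ← ContinuousLinearMap.orthogonalComplement_iSup_eigenspaces_eq_bot hc hS,
      ← Submodule.orthogonal_closure]
    refine Submodule.orthogonal_le (iSup_le fun c x hx => ?_)
    have h1 := (b c).hasSum_repr ⟨x, hx⟩
    have h2 := (Submodule.subtypeL _).hasSum h1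
    refine (Submodule.isClosed_topologicalClosure _).mem_of_tendsto h2
      (Filter.Eventually.of_forall fun s => Submodule.sum_mem _ fun i _ => ?_)
    refine Submodule.le_topologicalClosure _ ?_
    rw [map_smul]
    exact Submodule.smul_mem _ _ (Submodule.subset_span ⟨⟨c, i⟩, rfl⟩)
  · rw [HilbertBasis.coe_mkOfOrthogonalEqBot]
    exact Module.End.mem_eigenspace_iff.1 (b j.1 j.2).2

/-- `|T| + T` and `|T| - T` are twice the positive and negative parts of `T`, hence positive. -/
theorem abs_re_inner_le_abs {T : H →L[ℂ] H} (hT : IsSelfAdjoint T) (x : H) :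
    |(inner ℂ x (T x)).re| ≤ (inner ℂ x (CFC.abs T x)).re := by
  have key : ∀ A B C : H →L[ℂ] H, A + B = 2 • C → 0 ≤ C →
      0 ≤ (inner ℂ x (A x)).re + (inner ℂ x (B x)).re := by
    intro A B C h hC
    rw [← Complex.add_re, ← inner_add_right, ← _root_.add_apply, h]
    exact ((ContinuousLinearMap.nonneg_iff_isPositive _).1
      (nsmul_nonneg hC 2)).re_inner_nonneg_right x
  rw [abs_le]
  constructor
  · have := key _ _ _ (CFC.abs_add_self T hT) (CFC.posPart_nonneg _)
    linarith
  · have h1 := CFC.abs_sub_self T hT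
    rw [sub_eq_add_neg] at h1
    have := key _ _ _ h1 (CFC.negPart_nonneg _)
    rw [_root_.neg_apply, inner_neg_right, Complex.neg_re] at this
    linarith

/-- The Powers-Størmer inequality. -/
theorem tsum_enorm_sqrt_sub_sq_le {ι : Type*} (e : HilbertBasis ι ℂ H) {ρ σ : H →L[ℂ] H}
    (hρ : ρ ∈ traceClassPos H) (hσ : σ ∈ traceClassPos H) :
    ∑' i, ‖CFC.sqrt ρ (e i) - CFC.sqrt σ (e i)‖ₑ ^ 2 ≤ traceNorm (ρ - σ) := by
  obtain ⟨S, hSdef⟩ : ∃ S : H →L[ℂ] H, S = CFC.sqrt ρ - CFC.sqrt σ := ⟨_, rfl⟩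
  have hSx : ∀ x, CFC.sqrt ρ x - CFC.sqrt σ x = S x := fun x => by rw [hSdef]; rfl
  have hρs := (sqrt_isPositive ρ).isSymmetric
  have hσs := (sqrt_isPositive σ).isSymmetric
  have hS : S.IsSymmetric := by
    rw [hSdef]
    exact hρs.sub hσs
  have hfin : ∑' i, ‖S (e i)‖ₑ ^ 2 ≠ ∞ := by
    refine ne_top_of_le_ne_top (b := 2 * (traceNorm ρ + traceNorm σ)) ?_ ?_
    · exact ENNReal.mul_ne_top (by simp) (ENNReal.add_ne_top.2 ⟨hρ.2, hσ.2⟩)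
    · rw [← tsum_sqrt_basis e hρ.1, ← tsum_sqrt_basis e hσ.1, ← ENNReal.tsum_add,
        ← ENNReal.tsum_mul_left]
      refine ENNReal.tsum_le_tsum fun i => ?_
      rw [← hSx]
      exact enorm_sub_sq_le _ _
  have hcomp := isCompactOperator_of_tsum_ne_top e hfin
  -- Both sides of the inequality are independent of the basis, so it may be checked on an
  -- eigenbasis of `S = √ρ - √σ`, where it holds term by term.
  obtain ⟨κ, f, hf⟩ := exists_hilbertBasis_eigenvectors hcomp hS
  have hsa : IsSelfAdjoint (ρ - σ) := hρ.1.isSelfAdjoint.sub hσ.1.isSelfAdjoint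
  have habs : (CFC.abs (ρ - σ)).IsPositive :=
    (ContinuousLinearMap.nonneg_iff_isPositive _).1 (CFC.abs_nonneg _)
  have h0 : ∀ j, ‖S (f j)‖ₑ ^ 2 ≤ ‖CFC.sqrt (CFC.abs (ρ - σ)) (f j)‖ₑ ^ 2 := by
    intro j
    obtain ⟨c, hc⟩ := hf j
    rw [← hSx] at hc ⊢
    have h1 := norm_sub_sq_le_abs_of_eigenvector (sqrt_isPositive ρ) (sqrt_isPositive σ)
      (f.orthonormal.1 j) hc
    rw [norm_sqrt_sq hρ.1, norm_sqrt_sq hσ.1, ← Complex.sub_re, ← inner_sub_right] at h1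
    rw [enorm_sq_eq_ofReal, enorm_sq_eq_ofReal, norm_sqrt_sq habs]
    exact ENNReal.ofReal_le_ofReal (h1.trans (abs_re_inner_le_abs hsa (f j)))
  have h3 : traceNorm (CFC.abs (ρ - σ)) = traceNorm (ρ - σ) := by
    rw [traceNorm, CFC.cfcAbs_cfcAbs, traceNorm]
  simp only [hSx]
  rw [tsum_enorm_sq_basis_eq e f hS, ← h3, ← tsum_sqrt_basis f habs]
  exact ENNReal.tsum_le_tsum h0

/-! ### Spectral projectors and the energy of a decomposition -/

namespace PosOp

variable (G : PosOp H)

/-- The square root of `G` as a positive self-adjoint operator. -/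
noncomputable def sqrtPosOp : PosOp H := ⟨G.sqrt, G.sqrt_selfAdjoint, G.sqrt_nonneg⟩

theorem sqrt_graph_symm {x u y v : H} (h : (x, u) ∈ G.sqrt.graph) (k : (y, v) ∈ G.sqrt.graph) :
    inner ℂ u y = inner ℂ x v :=
  G.sqrtPosOp.graph_symm h k

theorem sqrt_eq_of_mem_graph {x u : H} (h : (x, u) ∈ G.sqrt.graph) (hx : x ∈ G.sqrt.domain) :
    G.sqrt ⟨x, hx⟩ = u :=
  LinearPMap.mem_graph_snd_inj _ (G.sqrt.mem_graph ⟨x, hx⟩) h rfl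

theorem domain_le_sqrt_domain {x : H} (hx : x ∈ G.op.domain) : x ∈ G.sqrt.domain := by
  obtain ⟨z, hz, -⟩ := (G.sqrt_sqrt _ _).1 (G.op.mem_graph ⟨x, hx⟩)
  exact LinearPMap.mem_domain_of_mem_graph hz

theorem norm_sqrt_sq_of_mem_graph {x u : H} (h : (x, u) ∈ G.op.graph) (hx : x ∈ G.sqrt.domain) :
    ((‖G.sqrt ⟨x, hx⟩‖ ^ 2 : ℝ) : ℂ) = inner ℂ x u := by
  obtain ⟨z, hz, hzu⟩ := (G.sqrt_sqrt _ _).1 h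
  rw [G.sqrt_eq_of_mem_graph hz, ← G.sqrt_graph_symm hz hzu, inner_self_eq_norm_sq_to_K]
  norm_cast

theorem specProj_specProj (n : ℕ) (x : H) : G.specProj n (G.specProj n x) = G.specProj n x :=
  Submodule.starProjection_eq_self_iff.2 (Submodule.starProjection_apply_mem _ x)

theorem specProj_symm (n : ℕ) (x y : H) :
    inner ℂ (G.specProj n x) y = inner ℂ x (G.specProj n y) :=
  Submodule.inner_starProjection_left_eq_right _ x y

theorem norm_specProj_le (n : ℕ) (x : H) : ‖G.specProj n x‖ ≤ ‖x‖ := by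
  refine (ContinuousLinearMap.le_opNorm _ _).trans ?_
  exact mul_le_of_le_one_left (norm_nonneg _) (Submodule.starProjection_norm_le _)

/-- `S` preserves the kernel of `G.cut n`; being symmetric, it also preserves the orthogonal
complement. -/
theorem specProj_comm_of_commute {S : H →L[ℂ] H} (hS : S.IsSymmetric) {n : ℕ}
    (hc : Commute S (G.cut n)) (x : H) : G.specProj n (S x) = S (G.specProj n x) := by
  have hinv : ∀ y ∈ (G.cut n).ker, S y ∈ (G.cut n).ker := by
    intro y hy
    have h : S (G.cut n y) = G.cut n (S y) := congrArg (fun T : H →L[ℂ] H => T y) hc.eq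
    rw [mem_ker_cut] at hy ⊢
    rw [← h, hy, map_zero]
  refine Submodule.eq_starProjection_of_mem_orthogonal (hinv _ ?_) ?_
  · exact Submodule.starProjection_apply_mem _ x
  · rw [← map_sub, Submodule.mem_orthogonal]
    intro y hy
    rw [← show inner ℂ (S y) _ = inner ℂ y (S _) from hS y _]
    exact Submodule.inner_right_of_mem_orthogonal (hinv y hy)
      (Submodule.sub_starProjection_mem_orthogonal x)

/-- `√G` commutes with the spectral projectors of `G`. -/
theorem specProj_sqrt_graph (n : ℕ) {x u : H} (h : (x, u) ∈ G.sqrt.graph) :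
    (G.specProj n x, G.specProj n u) ∈ G.sqrt.graph := by
  have hc : Commute G.sqrtCompl (G.cut n) :=
    ((Commute.one_left _).sub_left (G.commute_cut n)).cfcₙ_nnreal NNReal.sqrt
  obtain ⟨ψ, rfl, rfl⟩ := G.mem_sqrt_graph.1 h
  rw [G.specProj_comm_of_commute G.sqrtRes_symm (G.commute_sqrtRes_cut n),
    G.specProj_comm_of_commute G.sqrtCompl_symm hc]
  exact G.mem_sqrt_graph.2 ⟨_, rfl, rfl⟩

theorem specProj_mem_sqrt_domain (n : ℕ) (x : H) : G.specProj n x ∈ G.sqrt.domain :=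
  G.domain_le_sqrt_domain (G.specProj_mem_domain n x)

theorem sqrt_specProj (n : ℕ) (x : G.sqrt.domain) :
    G.sqrt ⟨G.specProj n x, G.specProj_mem_sqrt_domain n x⟩ = G.specProj n (G.sqrt x) :=
  G.sqrt_eq_of_mem_graph (G.specProj_sqrt_graph n (G.sqrt.mem_graph x)) _

theorem truncation_graph (n : ℕ) (x : H) : (G.specProj n x, G.truncation n x) ∈ G.op.graph :=
  G.op.mem_graph ⟨G.specProj n x, G.specProj_mem_domain n x⟩

theorem specProj_truncation (n : ℕ) (x : H) :
    G.specProj n (G.truncation n x) = G.truncation n x := by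
  have h := G.specProj_graph n (G.truncation_graph n x)
  rw [specProj_specProj] at h
  exact LinearPMap.mem_graph_snd_inj _ h (G.truncation_graph n x) rfl

/-- By Hellinger–Toeplitz, symmetry of this everywhere defined operator already makes it bounded. -/
theorem truncation_symm (n : ℕ) : (G.truncation n).IsSymmetric := by
  intro x y
  have h1 := G.graph_symm (G.truncation_graph n x) (G.truncation_graph n y)
  rwa [← specProj_symm, specProj_truncation, specProj_symm, specProj_truncation] at h1

/-- The bounded operator `G P` for the spectral projector `P` of `G` for `[0, n]`. -/
noncomputable def truncationCLM (n : ℕ) : H →L[ℂ] H :=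
  ⟨G.truncation n, (G.truncation_symm n).continuous⟩

theorem inner_truncation (n : ℕ) (x : H) : inner ℂ x (G.truncation n x) =
    ((‖G.sqrt ⟨G.specProj n x, G.specProj_mem_sqrt_domain n x⟩‖ ^ 2 : ℝ) : ℂ) := by
  rw [G.norm_sqrt_sq_of_mem_graph (G.truncation_graph n x), specProj_symm, specProj_truncation]

theorem tendsto_specProj (x : H) :
    Filter.Tendsto (fun n => G.specProj n x) Filter.atTop (nhds x) := by
  rw [Metric.tendsto_atTop]
  intro ε hε
  obtain ⟨y, hy, hxy⟩ := Metric.mem_closure_iff.1 (G.selfAdjoint.dense_domain x) (ε / 3)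
    (by positivity)
  set u := G.op ⟨y, hy⟩
  have hu : (y, u) ∈ G.op.graph := G.op.mem_graph ⟨y, hy⟩
  obtain ⟨N, hN⟩ := exists_nat_gt (‖u‖ / (ε / 3))
  refine ⟨N, fun n hn => ?_⟩
  have hn' : ‖u‖ < n * (ε / 3) := by
    rw [div_lt_iff₀ (by positivity)] at hN
    have : (N : ℝ) ≤ n := by exact_mod_cast hn
    nlinarith
  set w := y - G.specProj n y with hw
  have hPw : G.specProj n w = 0 := by rw [hw, map_sub, specProj_specProj, sub_self]
  -- On the kernel of `Pₙ`, `n‖w‖² < Re ⟨w, G w⟩ = Re ⟨w, u⟩ ≤ ‖w‖ ‖u‖` for `w ≠ 0`, so `‖w‖` is at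
  -- most of order `‖u‖ / n`.
  have hwy : ‖w‖ ≤ ε / 3 := by
    by_cases h0 : w = 0
    · rw [h0, norm_zero]; positivity
    have h1 := G.lt_of_specProj_eq_zero n (G.op.graph.sub_mem hu (G.specProj_graph n hu)) hPw h0
    change (n : ℝ) * ‖w‖ ^ 2 < (inner ℂ w (u - G.specProj n u)).re at h1
    rw [inner_sub_right, ← specProj_symm, hPw, inner_zero_left, sub_zero] at h1
    have h2 := (Complex.re_le_norm _).trans (norm_inner_le_norm w u)
    have h3 := norm_pos_iff.2 h0
    by_contra! h4
    nlinarith [mul_le_mul_of_nonneg_left h4.le (Nat.cast_nonneg (α := ℝ) n)]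
  have h5 : G.specProj n x - x = G.specProj n (x - y) - w - (x - y) := by
    rw [hw, map_sub]; abel
  rw [dist_eq_norm] at hxy ⊢
  rw [h5]
  calc ‖G.specProj n (x - y) - w - (x - y)‖
      ≤ ‖G.specProj n (x - y)‖ + ‖w‖ + ‖x - y‖ :=
        (norm_sub_le _ _).trans (add_le_add_left (norm_sub_le _ _) _)
    _ < ε := by linarith [G.norm_specProj_le n (x - y)]

/-- A vector `x` with bounded `‖√G Pₙ x‖` lies in the domain of `√G`. -/
theorem mem_sqrt_domain_of_bounded {x : H} {C : ℝ}
    (h : ∀ n, ‖G.sqrt ⟨G.specProj n x, G.specProj_mem_sqrt_domain n x⟩‖ ≤ C) :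
    x ∈ G.sqrt.domain := by
  -- As `√G` is self-adjoint, it is enough that `v ↦ ⟨x, √G v⟩` is bounded, which follows from the
  -- uniform bound on `⟨√G Pₙ x, v⟩`.
  have h1 : x ∈ (LinearPMap.adjoint G.sqrt).domain := by
    rw [LinearPMap.mem_adjoint_domain_iff]
    refine AddMonoidHomClass.continuous_of_bound _ C fun v => ?_
    have h2 : Filter.Tendsto (fun n => ‖inner ℂ (G.specProj n x) (G.sqrt v)‖) Filter.atTop
        (nhds ‖inner ℂ x (G.sqrt v)‖) :=
      ((G.tendsto_specProj x).inner tendsto_const_nhds).norm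
    refine le_of_tendsto h2 (Filter.Eventually.of_forall fun n => ?_)
    rw [← G.sqrt_graph_symm (G.sqrt.mem_graph ⟨G.specProj n x, G.specProj_mem_sqrt_domain n x⟩)
      (G.sqrt.mem_graph v)]
    exact (norm_inner_le_norm _ _).trans (mul_le_mul_of_nonneg_right (h n) (norm_nonneg _))
  rwa [LinearPMap.isSelfAdjoint_def.1 G.sqrt_selfAdjoint] at h1

theorem tendsto_sqrt_specProj (x : G.sqrt.domain) :
    Filter.Tendsto (fun n => G.sqrt ⟨G.specProj n x, G.specProj_mem_sqrt_domain n x⟩)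
      Filter.atTop (nhds (G.sqrt x)) := by
  simp only [sqrt_specProj]
  exact G.tendsto_specProj _

theorem energy_eq {ι : Type*} {ρ : H →L[ℂ] H} {φ : ι → H} (h : IsWeakSum ρ φ φ)
    (hs : ∑' k, ‖φ k‖ₑ ^ 2 ≠ ∞) : G.energy ρ =
      ⨆ n, ∑' k, ‖G.sqrt ⟨G.specProj n (φ k), G.specProj_mem_sqrt_domain n (φ k)⟩‖ₑ ^ 2 := by
  rw [energy]
  congr 1
  ext1 n
  have h1 := h.trace_comp (by simpa only [← sq] using hs) (G.truncationCLM n)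
  have h2 : HasSum (fun k => ‖G.sqrt ⟨G.specProj n (φ k), G.specProj_mem_sqrt_domain n (φ k)⟩‖ ^ 2)
      (trace (G.truncation n ∘ₗ ρ.toLinearMap)).re := by
    have h3 := Complex.hasSum_re h1
    have h4 : ∀ k, (inner ℂ (φ k) (G.truncationCLM n (φ k))).re =
        ‖G.sqrt ⟨G.specProj n (φ k), G.specProj_mem_sqrt_domain n (φ k)⟩‖ ^ 2 := fun k => by
      rw [← Complex.ofReal_re (‖_‖ ^ 2), ← G.inner_truncation]
      rfl
    simp only [h4] at h3
    exact h3
  simp only [enorm_sq_eq_ofReal]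
  rw [← ENNReal.ofReal_tsum_of_nonneg (fun _ => by positivity) h2.summable, h2.tsum_eq]

/-- With `tsum_sqrt_le_energy` this gives `Tr G ρ = ∑ ‖√G φₖ‖²`. This half holds because `Pₙ` is a
contraction commuting with `√G`; the other passes to the limit `n → ∞` in finite partial sums. -/
theorem energy_le {ι : Type*} {ρ : H →L[ℂ] H} {φ : ι → G.sqrt.domain}
    (h : IsWeakSum ρ (fun k => (φ k : H)) (fun k => (φ k : H)))
    (hs : ∑' k, ‖(φ k : H)‖ₑ ^ 2 ≠ ∞) : G.energy ρ ≤ ∑' k, ‖G.sqrt (φ k)‖ₑ ^ 2 := by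
  rw [G.energy_eq h hs]
  refine iSup_le fun n => ENNReal.tsum_le_tsum fun k => ?_
  rw [sqrt_specProj]
  gcongr
  rw [enorm_le_iff_norm_le]
  exact G.norm_specProj_le n _

theorem mem_sqrt_domain_of_energy {ι : Type*} {ρ : H →L[ℂ] H} {φ : ι → H} (h : IsWeakSum ρ φ φ)
    (hs : ∑' k, ‖φ k‖ₑ ^ 2 ≠ ∞) (hE : G.energy ρ < ∞) (k : ι) : φ k ∈ G.sqrt.domain := by
  -- Any uniform bound will do; `t² ≤ e` implies `t ≤ 1 + e`.
  refine G.mem_sqrt_domain_of_bounded (C := 1 + (G.energy ρ).toReal) fun n => ?_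
  have h1 : ‖G.sqrt ⟨G.specProj n (φ k), G.specProj_mem_sqrt_domain n (φ k)⟩‖ₑ ^ 2
      ≤ G.energy ρ := by
    rw [G.energy_eq h hs]
    exact (ENNReal.le_tsum k).trans (le_iSup (fun n => ∑' k,
      ‖G.sqrt ⟨G.specProj n (φ k), G.specProj_mem_sqrt_domain n (φ k)⟩‖ₑ ^ 2) n)
  rw [enorm_sq_eq_ofReal, ENNReal.ofReal_le_iff_le_toReal hE.ne] at h1
  nlinarith [ENNReal.toReal_nonneg (a := G.energy ρ),
    norm_nonneg (G.sqrt ⟨G.specProj n (φ k), G.specProj_mem_sqrt_domain n (φ k)⟩)]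

theorem tsum_sqrt_le_energy {ι : Type*} {ρ : H →L[ℂ] H} {φ : ι → G.sqrt.domain}
    (h : IsWeakSum ρ (fun k => (φ k : H)) (fun k => (φ k : H)))
    (hs : ∑' k, ‖(φ k : H)‖ₑ ^ 2 ≠ ∞) : ∑' k, ‖G.sqrt (φ k)‖ₑ ^ 2 ≤ G.energy ρ := by
  rw [ENNReal.tsum_eq_iSup_sum]
  refine iSup_le fun s => ?_
  have h1 : Filter.Tendsto (fun n => ∑ k ∈ s,
      ‖G.sqrt ⟨G.specProj n (φ k), G.specProj_mem_sqrt_domain n (φ k)⟩‖ₑ ^ 2) Filter.atTop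
      (nhds (∑ k ∈ s, ‖G.sqrt (φ k)‖ₑ ^ 2)) :=
    tendsto_finsetSum _ fun k _ =>
      ((ENNReal.continuous_pow 2).tendsto _).comp (G.tendsto_sqrt_specProj (φ k)).enorm
  refine le_of_tendsto h1 (Filter.Eventually.of_forall fun n => ?_)
  rw [G.energy_eq h hs]
  exact (ENNReal.sum_le_tsum s).trans (le_iSup (fun n => ∑' k,
    ‖G.sqrt ⟨G.specProj n (φ k), G.specProj_mem_sqrt_domain n (φ k)⟩‖ₑ ^ 2) n)

end PosOp

/-! ### Relatively bounded operators and well-definedness of `A ρ B*` -/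

namespace PosOp

variable {G : PosOp H}

theorem IsBoundPair.norm_le {A : G.sqrt.domain →ₗ[ℂ] H} {a b : ℝ} (h : G.IsBoundPair A a b)
    (φ : G.sqrt.domain) : ‖A φ‖ ≤ a * ‖(φ : H)‖ + b * ‖G.sqrt φ‖ := by
  have h1 := h.2.2 φ
  have h2 := mul_nonneg h.1 (norm_nonneg (φ : H))
  have h3 := mul_nonneg h.2.1 (norm_nonneg (G.sqrt φ))
  refine abs_le_of_sq_le_sq' ?_ (by positivity) |>.2
  nlinarith [mul_nonneg h2 h3]

theorem IsBoundPair.tsum_ne_top {A : G.sqrt.domain →ₗ[ℂ] H} {a b : ℝ} (h : G.IsBoundPair A a b)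
    {ι : Type*} {φ : ι → G.sqrt.domain} (hs : ∑' k, ‖(φ k : H)‖ₑ ^ 2 ≠ ∞)
    (hE : ∑' k, ‖G.sqrt (φ k)‖ₑ ^ 2 ≠ ∞) : ∑' k, ‖A (φ k)‖ₑ ^ 2 ≠ ∞ := by
  refine ne_top_of_le_ne_top (b := ENNReal.ofReal (a ^ 2) * (∑' k, ‖(φ k : H)‖ₑ ^ 2) +
    ENNReal.ofReal (b ^ 2) * ∑' k, ‖G.sqrt (φ k)‖ₑ ^ 2) ?_ ?_
  · exact ENNReal.add_ne_top.2 ⟨ENNReal.mul_ne_top ENNReal.ofReal_ne_top hs,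
      ENNReal.mul_ne_top ENNReal.ofReal_ne_top hE⟩
  · rw [← ENNReal.tsum_mul_left, ← ENNReal.tsum_mul_left, ← ENNReal.tsum_add]
    refine ENNReal.tsum_le_tsum fun k => ?_
    simp only [enorm_sq_eq_ofReal]
    rw [← ENNReal.ofReal_mul (by positivity), ← ENNReal.ofReal_mul (by positivity),
      ← ENNReal.ofReal_add (by positivity) (by positivity)]
    exact ENNReal.ofReal_le_ofReal (h.2.2 _)

/-- `A Pₙ` is a bounded operator if `A` is `√G`-bounded. -/
theorem IsBoundPair.exists_comp_specProj {A : G.sqrt.domain →ₗ[ℂ] H} {a b : ℝ}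
    (h : G.IsBoundPair A a b) (n : ℕ) :
    ∃ K : H →L[ℂ] H, ∀ x, K x = A ⟨G.specProj n x, G.specProj_mem_sqrt_domain n x⟩ := by
  let K : H →ₗ[ℂ] H := A ∘ₗ (G.specProj n).toLinearMap.codRestrict G.sqrt.domain
    (G.specProj_mem_sqrt_domain n)
  have hK : ∀ x, K x = A ⟨G.specProj n x, G.specProj_mem_sqrt_domain n x⟩ := fun x => rfl
  -- `‖√G Pₙ x‖² = ⟨x, G Pₙ x⟩ ≤ ‖G Pₙ‖ ‖x‖²`, and `1 + ‖G Pₙ‖` dominates the square root of `‖G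
  -- Pₙ‖`.
  refine ⟨K.mkContinuous (a + b * (1 + ‖G.truncationCLM n‖)) fun x => ?_, fun x => rfl⟩
  rw [hK]
  refine (h.norm_le _).trans ?_
  have h1 : ‖G.sqrt ⟨G.specProj n x, G.specProj_mem_sqrt_domain n x⟩‖ ≤
      (1 + ‖G.truncationCLM n‖) * ‖x‖ := by
    have h2 := congrArg Complex.re (G.inner_truncation n x)
    rw [Complex.ofReal_re] at h2
    have h3 : (inner ℂ x (G.truncation n x)).re ≤ ‖x‖ * (‖G.truncationCLM n‖ * ‖x‖) :=
      (Complex.re_le_norm _).trans ((norm_inner_le_norm _ _).trans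
        (mul_le_mul_of_nonneg_left ((G.truncationCLM n).le_opNorm x) (norm_nonneg _)))
    refine abs_le_of_sq_le_sq' ?_ (by positivity) |>.2
    rw [← h2]
    refine h3.trans ?_
    nlinarith [mul_nonneg (norm_nonneg (G.truncationCLM n)) (sq_nonneg ‖x‖), sq_nonneg ‖x‖,
      mul_nonneg (sq_nonneg ‖G.truncationCLM n‖) (sq_nonneg ‖x‖)]
  have h4 := mul_le_mul_of_nonneg_left h1 h.2.1
  have h5 := mul_le_mul_of_nonneg_left (G.norm_specProj_le n x) h.1
  change a * ‖G.specProj n x‖ + _ ≤ _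
  linarith

/-- `A` is continuous for the graph norm of `√G`, and `Pₙ x → x` in that norm. -/
theorem IsBoundPair.tendsto_comp_specProj {A : G.sqrt.domain →ₗ[ℂ] H} {a b : ℝ}
    (h : G.IsBoundPair A a b) (x : G.sqrt.domain) :
    Filter.Tendsto (fun n => A ⟨G.specProj n x, G.specProj_mem_sqrt_domain n x⟩) Filter.atTop
      (nhds (A x)) := by
  rw [tendsto_iff_norm_sub_tendsto_zero]
  have h1 := tendsto_iff_norm_sub_tendsto_zero.1 (G.tendsto_specProj (x : H))
  have h2 := tendsto_iff_norm_sub_tendsto_zero.1 (G.tendsto_sqrt_specProj x)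
  have h3 := (h1.const_mul a).add (h2.const_mul b)
  rw [mul_zero, mul_zero, add_zero] at h3
  refine squeeze_zero (fun _ => norm_nonneg _) (fun n => ?_) h3
  rw [← map_sub, ← LinearPMap.map_sub]
  exact h.norm_le _

theorem IsBoundPair.norm_comp_specProj_sq_le {A : G.sqrt.domain →ₗ[ℂ] H} {a b : ℝ}
    (h : G.IsBoundPair A a b) (n : ℕ) (x : G.sqrt.domain) :
    ‖A ⟨G.specProj n x, G.specProj_mem_sqrt_domain n x⟩‖ ^ 2 ≤
      a ^ 2 * ‖(x : H)‖ ^ 2 + b ^ 2 * ‖G.sqrt x‖ ^ 2 := by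
  refine (h.2.2 _).trans ?_
  rw [sqrt_specProj]
  gcongr
  · exact G.norm_specProj_le n x
  · exact G.norm_specProj_le n _

theorem summable_norm_sq {F ι : Type*} [NormedAddCommGroup F] {f : ι → F}
    (h : ∑' k, ‖f k‖ₑ ^ 2 ≠ ∞) : Summable fun k => ‖f k‖ ^ 2 := by
  have h1 := ENNReal.summable_toReal h
  simpa using h1

/-- The form of `∑ₖ |A φₖ⟩⟨B φₖ|` is the limit of the forms of `(A Pₙ) ρ (B Pₙ)*`. -/
theorem tendsto_inner_weakSum {A B : G.sqrt.domain →ₗ[ℂ] H} {a b a' b' : ℝ}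
    (hA : G.IsBoundPair A a b) (hB : G.IsBoundPair B a' b') {ρ T : H →L[ℂ] H} {ι : Type*}
    {φ : ι → G.sqrt.domain} (h : IsWeakSum ρ (fun k => (φ k : H)) (fun k => (φ k : H)))
    (hs : ∑' k, ‖(φ k : H)‖ₑ ^ 2 ≠ ∞) (hE : ∑' k, ‖G.sqrt (φ k)‖ₑ ^ 2 ≠ ∞)
    (hT : IsWeakSum T (fun k => A (φ k)) (fun k => B (φ k))) {K L : ℕ → H →L[ℂ] H}
    (hK : ∀ n x, K n x = A ⟨G.specProj n x, G.specProj_mem_sqrt_domain n x⟩)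
    (hL : ∀ n x, L n x = B ⟨G.specProj n x, G.specProj_mem_sqrt_domain n x⟩) (u v : H) :
    Filter.Tendsto (fun n => inner ℂ u ((K n ∘L ρ ∘L (L n).adjoint) v)) Filter.atTop
      (nhds (inner ℂ u (T v))) := by
  have h1 : ∀ n, inner ℂ u ((K n ∘L ρ ∘L (L n).adjoint) v) =
      ∑' k, inner ℂ u (K n (φ k)) * inner ℂ (L n (φ k)) v :=
    fun n => ((h.map (K n) (L n) u v).tsum_eq).symm
  rw [funext h1, ← (hT u v).tsum_eq]
  have hs' := summable_norm_sq hs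
  have hE' := summable_norm_sq hE
  -- The projectors increase neither `‖φₖ‖` nor `‖√G φₖ‖`, so the majorant does not depend on `n`;
  -- finite mass and energy make it summable.
  refine tendsto_tsum_of_dominated_convergence (bound := fun k => ‖u‖ * ‖v‖ *
    ((a ^ 2 * ‖(φ k : H)‖ ^ 2 + b ^ 2 * ‖G.sqrt (φ k)‖ ^ 2) +
      (a' ^ 2 * ‖(φ k : H)‖ ^ 2 + b' ^ 2 * ‖G.sqrt (φ k)‖ ^ 2))) ?_ (fun k => ?_)
    (Filter.Eventually.of_forall fun n k => ?_)
  · exact ((((hs'.mul_left _).add (hE'.mul_left _))).add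
      ((hs'.mul_left _).add (hE'.mul_left _))).mul_left _
  · simp only [hK, hL]
    exact (tendsto_const_nhds.inner (hA.tendsto_comp_specProj (φ k))).mul
      ((hB.tendsto_comp_specProj (φ k)).inner tendsto_const_nhds)
  · have h2 := hA.norm_comp_specProj_sq_le n (φ k)
    have h3 := hB.norm_comp_specProj_sq_le n (φ k)
    rw [← hK] at h2
    rw [← hL] at h3
    rw [norm_mul]
    calc ‖inner ℂ u (K n (φ k))‖ * ‖inner ℂ (L n (φ k)) v‖
        ≤ (‖u‖ * ‖K n (φ k)‖) * (‖L n (φ k)‖ * ‖v‖) :=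
          mul_le_mul (norm_inner_le_norm _ _) (norm_inner_le_norm _ _) (norm_nonneg _)
            (by positivity)
      _ = ‖u‖ * ‖v‖ * (‖K n (φ k)‖ * ‖L n (φ k)‖) := by ring
      _ ≤ _ := by
        refine mul_le_mul_of_nonneg_left ?_ (by positivity)
        nlinarith [sq_nonneg (‖K n (φ k)‖ - ‖L n (φ k)‖), sq_nonneg ‖K n (φ k)‖,
          sq_nonneg ‖L n (φ k)‖]

/-- The sum `∑ₖ |A φₖ⟩⟨B φₖ|` does not depend on the decomposition `ρ = ∑ₖ |φₖ⟩⟨φₖ|`. -/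
theorem weakSum_unique {A B : G.sqrt.domain →ₗ[ℂ] H} (hA : G.IsSqrtBounded A)
    (hB : G.IsSqrtBounded B) {ρ T S : H →L[ℂ] H} {ι κ : Type*}
    {φ : ι → G.sqrt.domain} (hφ : IsWeakSum ρ (fun k => (φ k : H)) (fun k => (φ k : H)))
    (hφs : ∑' k, ‖(φ k : H)‖ₑ ^ 2 ≠ ∞) (hφE : ∑' k, ‖G.sqrt (φ k)‖ₑ ^ 2 ≠ ∞)
    (hT : IsWeakSum T (fun k => A (φ k)) (fun k => B (φ k)))
    {ψ : κ → G.sqrt.domain} (hψ : IsWeakSum ρ (fun k => (ψ k : H)) (fun k => (ψ k : H)))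
    (hψs : ∑' k, ‖(ψ k : H)‖ₑ ^ 2 ≠ ∞) (hψE : ∑' k, ‖G.sqrt (ψ k)‖ₑ ^ 2 ≠ ∞)
    (hS : IsWeakSum S (fun k => A (ψ k)) (fun k => B (ψ k))) : T = S := by
  obtain ⟨a, b, hA⟩ := hA
  obtain ⟨a', b', hB⟩ := hB
  choose K hK using hA.exists_comp_specProj
  choose L hL using hB.exists_comp_specProj
  ext v
  refine ext_inner_left ℂ fun u => ?_
  -- The approximants `(A Pₙ) ρ (B Pₙ)*` involve `ρ` alone, not its decomposition.
  exact tendsto_nhds_unique (tendsto_inner_weakSum hA hB hφ hφs hφE hT hK hL u v)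
    (tendsto_inner_weakSum hA hB hψ hψs hψE hS hK hL u v)

theorem IsSqrtBounded.tsum_mul_ne_top {A B : G.sqrt.domain →ₗ[ℂ] H} (hA : G.IsSqrtBounded A)
    (hB : G.IsSqrtBounded B) {ι : Type*} {φ : ι → G.sqrt.domain}
    (hs : ∑' k, ‖(φ k : H)‖ₑ ^ 2 ≠ ∞) (hE : ∑' k, ‖G.sqrt (φ k)‖ₑ ^ 2 ≠ ∞) :
    ∑' k, ‖A (φ k)‖ₑ * ‖B (φ k)‖ₑ ≠ ∞ := by
  obtain ⟨a, b, hA⟩ := hA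
  obtain ⟨a', b', hB⟩ := hB
  have key : ∀ x : ℝ≥0∞, x = (x ^ (1 / 2 : ℝ)) ^ 2 := fun x => by
    rw [← ENNReal.rpow_two, ← ENNReal.rpow_mul]; norm_num
  refine ne_top_of_le_ne_top ?_ (tsum_mul_le_of_tsum_sq_le (key _).le (key _).le)
  exact ENNReal.mul_ne_top (ENNReal.rpow_ne_top_of_nonneg (by norm_num) (hA.tsum_ne_top hs hE))
    (ENNReal.rpow_ne_top_of_nonneg (by norm_num) (hB.tsum_ne_top hs hE))

theorem isSandwich_of_weakSum {A B : G.sqrt.domain →ₗ[ℂ] H} (hA : G.IsSqrtBounded A)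
    (hB : G.IsSqrtBounded B) {ρ T : H →L[ℂ] H} (hρ : ρ ∈ G.finiteEnergy) {ι : Type*}
    {φ : ι → G.sqrt.domain} (hφ : IsWeakSum ρ (fun k => (φ k : H)) (fun k => (φ k : H)))
    (hT : IsWeakSum T (fun k => A (φ k)) (fun k => B (φ k))) : G.IsSandwich A B ρ T := by
  intro ψ hψ
  have hψw : IsWeakSum ρ ψ ψ := isWeakSum_of_hasSum hψ
  have hφs : ∑' k, ‖(φ k : H)‖ₑ ^ 2 ≠ ∞ := by rw [← hφ.traceNorm_eq]; exact hρ.1.2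
  have hψs : ∑' k, ‖ψ k‖ₑ ^ 2 ≠ ∞ := by rw [← hψw.traceNorm_eq]; exact hρ.1.2
  have hφE := ne_top_of_le_ne_top hρ.2.ne (G.tsum_sqrt_le_energy hφ hφs)
  have hmem := G.mem_sqrt_domain_of_energy hψw hψs hρ.2
  have hψE := ne_top_of_le_ne_top hρ.2.ne
    (G.tsum_sqrt_le_energy (φ := fun k => ⟨ψ k, hmem k⟩) hψw hψs)
  refine ⟨hmem, ?_⟩
  obtain ⟨S, hS⟩ := exists_hasSum_rankOne (hA.tsum_mul_ne_top hB hψs hψE)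
  rwa [weakSum_unique hA hB hφ hφs hφE hT (ψ := fun k => ⟨ψ k, hmem k⟩) hψw hψs hψE
    (isWeakSum_of_hasSum hS)]

/-- Over any decomposition `ρ = ∑ₖ |φₖ⟩⟨φₖ|` the operator `A ρ B*` is `∑ₖ |A φₖ⟩⟨B φₖ|`. -/
theorem isWeakSum_sandwich [TopologicalSpace.SeparableSpace H] {A B : G.sqrt.domain →ₗ[ℂ] H}
    (hA : G.IsSqrtBounded A) (hB : G.IsSqrtBounded B) {ρ : H →L[ℂ] H} (hρ : ρ ∈ G.finiteEnergy)
    {ι : Type*} {φ : ι → G.sqrt.domain}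
    (hφ : IsWeakSum ρ (fun k => (φ k : H)) (fun k => (φ k : H))) :
    G.IsSandwich A B ρ (G.sandwich A B ρ) ∧
      IsWeakSum (G.sandwich A B ρ) (fun k => A (φ k)) (fun k => B (φ k)) := by
  have hφs : ∑' k, ‖(φ k : H)‖ₑ ^ 2 ≠ ∞ := by rw [← hφ.traceNorm_eq]; exact hρ.1.2
  have hφE := ne_top_of_le_ne_top hρ.2.ne (G.tsum_sqrt_le_energy hφ hφs)
  obtain ⟨T, hT⟩ := exists_hasSum_rankOne (hA.tsum_mul_ne_top hB hφs hφE)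
  have hTw := isWeakSum_of_hasSum hT
  have h1 := isSandwich_of_weakSum hA hB hρ hφ hTw
  have h2 : ∃ T, G.IsSandwich A B ρ T := ⟨T, h1⟩
  have h3 : G.IsSandwich A B ρ (G.sandwich A B ρ) := by
    rw [sandwich, dif_pos h2]
    exact h2.choose_spec
  -- `IsSandwich` quantifies over all decompositions, so it determines its value only once some
  -- decomposition indexed by `ℕ` exists.
  obtain ⟨ψ, hψ⟩ := exists_isDecomposition hρ.1
  obtain ⟨_, h4⟩ := h1 ψ hψ
  obtain ⟨_, h5⟩ := h3 ψ hψ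
  refine ⟨h3, ?_⟩
  rwa [h5.unique h4]

/-- The decomposition `ρ = ∑ᵢ |√ρ eᵢ⟩⟨√ρ eᵢ|` over the standard basis has all its vectors in the
domain of `√G` if `Tr G ρ < ∞`. -/
theorem sqrt_basis_mem_sqrt_domain {ρ : H →L[ℂ] H} (hρ : ρ ∈ G.finiteEnergy)
    (i : basisIndex H) : CFC.sqrt ρ (basis H i) ∈ G.sqrt.domain :=
  G.mem_sqrt_domain_of_energy (isWeakSum_sqrt (basis H) hρ.1.1)
    (by rw [tsum_sqrt_basis _ hρ.1.1]; exact hρ.1.2) hρ.2 i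

theorem isSandwich_sandwich [TopologicalSpace.SeparableSpace H] {A B : G.sqrt.domain →ₗ[ℂ] H}
    (hA : G.IsSqrtBounded A) (hB : G.IsSqrtBounded B) {ρ : H →L[ℂ] H}
    (hρ : ρ ∈ G.finiteEnergy) :
    G.IsSandwich A B ρ (G.sandwich A B ρ) ∧ IsTraceClass (G.sandwich A B ρ) := by
  have h0 := isWeakSum_sqrt (basis H) hρ.1.1
  have hs : ∑' i, ‖CFC.sqrt ρ (basis H i)‖ₑ ^ 2 ≠ ∞ := by
    rw [tsum_sqrt_basis _ hρ.1.1]; exact hρ.1.2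
  have h1 := isWeakSum_sandwich hA hB hρ
    (φ := fun i => ⟨CFC.sqrt ρ (basis H i), sqrt_basis_mem_sqrt_domain hρ i⟩) h0
  have hE := ne_top_of_le_ne_top hρ.2.ne (G.tsum_sqrt_le_energy
    (φ := fun i => ⟨CFC.sqrt ρ (basis H i), sqrt_basis_mem_sqrt_domain hρ i⟩) h0 hs)
  exact ⟨h1.1, ne_top_of_le_ne_top (hA.tsum_mul_ne_top hB hs hE) h1.2.traceNorm_le⟩

end PosOp

/-! ### The S-lemma -/

theorem exists_phase (w : ℂ) : ∃ c : ℂ, ‖c‖ = 1 ∧ (c * w).re = 0 := by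
  by_cases h : w = 0
  · exact ⟨1, by simp, by simp [h]⟩
  · have hw : ‖w‖ ≠ 0 := norm_ne_zero_iff.2 h
    refine ⟨Complex.I * (starRingEnd ℂ w) / ‖w‖, ?_, ?_⟩
    · simp [hw]
    · have : Complex.I * (starRingEnd ℂ w) / ‖w‖ * w = Complex.I * ‖w‖ := by
        have hw' : (‖w‖ : ℂ) ≠ 0 := by exact_mod_cast hw
        field_simp
        rw [Complex.conj_mul']
      rw [this]
      simp

/-- The S-lemma for a Hermitian form `q` and a quadratic form `r` on a complex vector space: if
`q x ≤ 0` implies `0 ≤ r x`, and `q` takes a negative value, then `0 ≤ r + c q` for some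
`c ≥ 0`. -/
theorem exists_multiplier {V : Type*} [AddCommGroup V] [Module ℂ V] {q r : V → ℝ}
    {h : V → V → ℂ} (hq_add : ∀ x y, q (x + y) = q x + q y + 2 * (h x y).re)
    (hh : ∀ x (c : ℂ) y, h x (c • y) = c * h x y)
    (hq_smul : ∀ (c : ℂ) x, q (c • x) = ‖c‖ ^ 2 * q x)
    (hr_add : ∀ x y, r (x + y) + r (x - y) = 2 * r x + 2 * r y)
    (hr_smul : ∀ (c : ℂ) x, r (c • x) = ‖c‖ ^ 2 * r x)
    (hqr : ∀ x, q x ≤ 0 → 0 ≤ r x) {z : V} (hz : q z < 0) :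
    ∃ c : ℝ, 0 ≤ c ∧ ∀ x, 0 ≤ r x + c * q x := by
  -- Rescale so that `q (s x) = -q (t y)` and rotate `t y` by a phase that kills the Hermitian cross
  -- term. Then `q` vanishes at `s x ± c t y`, `r ≥ 0` at both, and the parallelogram identity for
  -- `r` gives the claim.
  have key : ∀ x y, 0 < q x → q y < 0 → 0 ≤ r x * (-q y) + r y * q x := by
    intro x y hx hy
    set s : ℂ := (Real.sqrt (-q y) : ℂ)
    set t : ℂ := (Real.sqrt (q x) : ℂ)
    have hs : ‖s‖ ^ 2 = -q y := by
      rw [Complex.norm_real, Real.norm_eq_abs, sq_abs, Real.sq_sqrt (by linarith)]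
    have ht : ‖t‖ ^ 2 = q x := by
      rw [Complex.norm_real, Real.norm_eq_abs, sq_abs, Real.sq_sqrt hx.le]
    obtain ⟨c, hc, hc0⟩ := exists_phase (h (s • x) (t • y))
    rw [← hh] at hc0
    have hy' : q (c • t • y) = q x * q y := by rw [hq_smul, hq_smul, hc, ht]; ring
    have hx' : q (s • x) = -(q x * q y) := by rw [hq_smul, hs]; ring
    have h1 : q (s • x + c • t • y) = 0 := by rw [hq_add, hx', hy', hc0]; ring
    have h2 : q (s • x - c • t • y) = 0 := by
      have h3 : h (s • x) ((-1 : ℂ) • c • t • y) = -h (s • x) (c • t • y) := by rw [hh]; ring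
      have h4 : q ((-1 : ℂ) • c • t • y) = q (c • t • y) := by rw [hq_smul]; simp
      rw [sub_eq_add_neg, ← neg_one_smul ℂ (c • t • y), hq_add, h3, h4, hx', hy',
        Complex.neg_re, hc0]
      ring
    have h5 := hr_add (s • x) (c • t • y)
    have h6 : r (s • x) = -q y * r x := by rw [hr_smul, hs]
    have h7 : r (c • t • y) = q x * r y := by rw [hr_smul, hr_smul, hc, ht]; ring
    have := hqr _ h1.le
    have := hqr _ h2.le
    rw [h6, h7] at h5
    nlinarith
  -- Each `x` with `q x > 0` bounds the multiplier below by `-r x / q x`, each `y` with `q y < 0`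
  -- bounds it above by `r y / -q y`; by `key` these bounds are compatible. Inserting `0` makes the
  -- supremum nonnegative, and `z` makes it finite.
  set S : Set ℝ := insert 0 {s | ∃ x, 0 < q x ∧ s = -r x / q x} with hS
  have hub : ∀ y, q y < 0 → ∀ s ∈ S, s ≤ r y / -q y := by
    rintro y hy s (rfl | ⟨x, hx, rfl⟩)
    · exact div_nonneg (hqr y hy.le) (by linarith)
    · rw [div_le_div_iff₀ hx (by linarith)]
      linarith [key x y hx hy]
  have hbdd : BddAbove S := ⟨_, hub z hz⟩
  refine ⟨sSup S, le_csSup hbdd (Set.mem_insert _ _), fun x => ?_⟩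
  rcases lt_trichotomy (q x) 0 with hx | hx | hx
  · have h1 := csSup_le ⟨0, Set.mem_insert _ _⟩ (hub x hx)
    rw [le_div_iff₀ (by linarith)] at h1
    linarith
  · rw [hx, mul_zero, add_zero]
    exact hqr x hx.le
  · have h1 : -r x / q x ≤ sSup S := le_csSup hbdd (Set.mem_insert_of_mem _ ⟨x, hx, rfl⟩)
    rw [div_le_iff₀ hx] at h1
    linarith

theorem IsWeakSum.ofReal_trace {ι : Type*} {ρ : H →L[ℂ] H} {φ : ι → H} (h : IsWeakSum ρ φ φ)
    (hs : ∑' k, ‖φ k‖ₑ ^ 2 ≠ ∞) : ENNReal.ofReal (trace ρ.toLinearMap).re = traceNorm ρ := by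
  have h1 := Complex.hasSum_re
    (h.trace_comp (by simpa only [← sq] using hs) (ContinuousLinearMap.id ℂ H))
  have h2 : HasSum (fun k => ‖φ k‖ ^ 2) (trace ρ.toLinearMap).re := by
    have h3 : ∀ k, (inner ℂ (φ k) (ContinuousLinearMap.id ℂ H (φ k))).re = ‖φ k‖ ^ 2 :=
      fun k => inner_self_eq_norm_sq (𝕜 := ℂ) (φ k)
    simp only [h3] at h1
    exact h1
  rw [h.traceNorm_eq]
  simp only [enorm_sq_eq_ofReal]
  rw [← ENNReal.ofReal_tsum_of_nonneg (fun _ => by positivity) h2.summable, h2.tsum_eq]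

/-- Joining both families over a disjoint union replaces the triangle inequality for the trace norm.
-/
theorem IsWeakSum.traceNorm_add_le {ι κ : Type*} {T S : H →L[ℂ] H} {a b : ι → H} {c d : κ → H}
    (hT : IsWeakSum T a b) (hS : IsWeakSum S c d) :
    traceNorm (T + S) ≤ (∑' k, ‖a k‖ₑ * ‖b k‖ₑ) + ∑' k, ‖c k‖ₑ * ‖d k‖ₑ := by
  have h : IsWeakSum (T + S) (Sum.elim a c) (Sum.elim b d) := by
    intro u v
    rw [_root_.add_apply, inner_add_right]
    exact HasSum.sum (hT u v) (hS u v)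
  refine h.traceNorm_le.trans (le_of_eq ?_)
  rw [Summable.tsum_sum ENNReal.summable ENNReal.summable]
  rfl

theorem isWeakSum_rankOne (x y : H) :
    IsWeakSum (InnerProductSpace.rankOne ℂ x y) (fun _ : Unit => x) (fun _ : Unit => y) :=
  isWeakSum_of_hasSum (hasSum_unique _)

/-! ### The operator `E`-norm and the continuity bound -/

namespace PosOp

variable {G : PosOp H}

theorem IsBoundPair.eNorm_le {A : G.sqrt.domain →ₗ[ℂ] H} {a b : ℝ} (h : G.IsBoundPair A a b)
    {E : ℝ} : G.eNorm A E ≤ ENNReal.ofReal (a + b * Real.sqrt E) := by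
  refine iSup_le fun φ => ?_
  rw [← ofReal_norm]
  refine ENNReal.ofReal_le_ofReal ((h.norm_le _).trans ?_)
  rw [φ.2.1, mul_one]
  gcongr
  · exact h.2.1
  · exact Real.le_sqrt_of_sq_le φ.2.2

theorem IsSqrtBounded.eNorm_ne_top {A : G.sqrt.domain →ₗ[ℂ] H} (h : G.IsSqrtBounded A)
    {E : ℝ} : G.eNorm A E ≠ ∞ := by
  obtain ⟨a, b, h⟩ := h
  exact ne_top_of_le_ne_top ENNReal.ofReal_ne_top h.eNorm_le

theorem IsSqrtBounded.norm_le_eNorm {A : G.sqrt.domain →ₗ[ℂ] H} (h : G.IsSqrtBounded A)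
    {E : ℝ} {φ : G.sqrt.domain} (hφ : ‖G.sqrt φ‖ ^ 2 ≤ E * ‖(φ : H)‖ ^ 2) :
    ‖A φ‖ ≤ (G.eNorm A E).toReal * ‖(φ : H)‖ := by
  by_cases h0 : (φ : H) = 0
  · have h1 : φ = 0 := Subtype.ext h0
    rw [h1, map_zero, norm_zero]
    simp
  have hn := norm_pos_iff.2 h0
  set c : ℂ := ((‖(φ : H)‖⁻¹ : ℝ) : ℂ) with hc
  have hcn : ‖c‖ = ‖(φ : H)‖⁻¹ := by
    rw [hc, Complex.norm_real, Real.norm_eq_abs, abs_of_pos (by positivity)]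
  have h1 : ‖((c • φ : G.sqrt.domain) : H)‖ = 1 := by
    rw [Submodule.coe_smul, norm_smul, hcn, inv_mul_cancel₀ hn.ne']
  have h2 : ‖G.sqrt (c • φ)‖ ^ 2 ≤ E := by
    rw [LinearPMap.map_smul, norm_smul, hcn, mul_pow, inv_pow, inv_mul_le_iff₀ (by positivity)]
    linarith
  have h3 : ‖A (c • φ)‖ₑ ≤ G.eNorm A E :=
    le_iSup (fun φ : {φ : G.sqrt.domain // ‖(φ : H)‖ = 1 ∧ ‖G.sqrt φ‖ ^ 2 ≤ E} => ‖A φ.1‖ₑ)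
      ⟨c • φ, h1, h2⟩
  rw [← ofReal_norm, ENNReal.ofReal_le_iff_le_toReal h.eNorm_ne_top, map_smul, norm_smul,
    hcn, inv_mul_le_iff₀ hn] at h3
  linarith

/-- Vectors in the domain of `√G` on which `G` is arbitrarily small. -/
theorem exists_sqrt_small (hinf : ∀ δ : ℝ, 0 < δ → ∃ φ : G.op.domain, ‖(φ : H)‖ = 1 ∧
    ‖G.op φ‖ < δ) {δ : ℝ} (hδ : 0 < δ) :
    ∃ φ : G.sqrt.domain, ‖(φ : H)‖ = 1 ∧ ‖G.sqrt φ‖ ^ 2 < δ := by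
  obtain ⟨φ, h1, h2⟩ := hinf δ hδ
  refine ⟨⟨φ, G.domain_le_sqrt_domain φ.2⟩, h1, ?_⟩
  have h3 := congrArg Complex.re
    (G.norm_sqrt_sq_of_mem_graph (G.op.mem_graph φ) (G.domain_le_sqrt_domain φ.2))
  rw [Complex.ofReal_re] at h3
  rw [h3]
  refine ((Complex.re_le_norm _).trans (norm_inner_le_norm _ _)).trans_lt ?_
  rwa [h1, one_mul]

/-- The square of the operator `E`-norm is attained by an affine majorant of `‖A φ‖²`. -/
theorem IsSqrtBounded.exists_majorant {A : G.sqrt.domain →ₗ[ℂ] H} (h : G.IsSqrtBounded A)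
    (hinf : ∀ δ : ℝ, 0 < δ → ∃ φ : G.op.domain, ‖(φ : H)‖ = 1 ∧ ‖G.op φ‖ < δ)
    {E : ℝ} (hE : 0 < E) : ∃ m c : ℝ, 0 ≤ m ∧ 0 ≤ c ∧ m + c * E = (G.eNorm A E).toReal ^ 2 ∧
      ∀ φ : G.sqrt.domain, ‖A φ‖ ^ 2 ≤ m * ‖(φ : H)‖ ^ 2 + c * ‖G.sqrt φ‖ ^ 2 := by
  set F := (G.eNorm A E).toReal with hF
  obtain ⟨z, hz1, hz2⟩ := exists_sqrt_small hinf hE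
  have hpar : ∀ x y : H, ‖x + y‖ ^ 2 + ‖x - y‖ ^ 2 = 2 * ‖x‖ ^ 2 + 2 * ‖y‖ ^ 2 := fun x y => by
    have := parallelogram_law_with_norm ℂ x y
    linarith
  have hadd : ∀ x y : H, ‖x + y‖ ^ 2 = ‖x‖ ^ 2 + ‖y‖ ^ 2 + 2 * (inner ℂ x y).re := fun x y => by
    have := norm_add_sq (𝕜 := ℂ) x y
    rw [RCLike.re_to_complex] at this
    linarith
  -- By homogeneity, `q φ ≤ 0 → 0 ≤ r φ` is the definition of the `E`-norm; `z` has energy strictly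
  -- below `E`.
  obtain ⟨c, hc, hcr⟩ := exists_multiplier
    (q := fun φ : G.sqrt.domain => ‖G.sqrt φ‖ ^ 2 - E * ‖(φ : H)‖ ^ 2)
    (r := fun φ : G.sqrt.domain => F ^ 2 * ‖(φ : H)‖ ^ 2 - ‖A φ‖ ^ 2)
    (h := fun x y : G.sqrt.domain => inner ℂ (G.sqrt x) (G.sqrt y) - E * inner ℂ (x : H) (y : H))
    (fun x y => by
      rw [LinearPMap.map_add, Submodule.coe_add, hadd, hadd, Complex.sub_re,
        Complex.re_ofReal_mul]
      ring)
    (fun x c y => by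
      rw [LinearPMap.map_smul, Submodule.coe_smul, inner_smul_right, inner_smul_right]
      ring)
    (fun c x => by
      rw [LinearPMap.map_smul, Submodule.coe_smul, norm_smul, norm_smul]
      ring)
    (fun x y => by
      have h1 := hpar (x : H) (y : H)
      have h2 := hpar (A x) (A y)
      rw [map_add, map_sub, Submodule.coe_add, Submodule.coe_sub]
      linear_combination F ^ 2 * h1 - h2)
    (fun c x => by
      rw [map_smul, Submodule.coe_smul, norm_smul, norm_smul]
      ring)
    (fun x hx => by
      have h1 := h.norm_le_eNorm (sub_nonpos.1 hx)
      have h2 := pow_le_pow_left₀ (norm_nonneg _) h1 2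
      rw [mul_pow] at h2
      exact sub_nonneg.2 h2)
    (z := z) (by rw [hz1]; linarith)
  have hcr' : ∀ φ : G.sqrt.domain, ‖A φ‖ ^ 2 ≤
      (F ^ 2 - c * E) * ‖(φ : H)‖ ^ 2 + c * ‖G.sqrt φ‖ ^ 2 := fun φ => by
    have := hcr φ
    linarith
  refine ⟨F ^ 2 - c * E, c, ?_, hc, by ring, hcr'⟩
  -- If `m = F² - cE < 0`, a unit vector `w` of energy below `-m / (c + 1)` makes `m + c‖√G w‖²`
  -- negative, although it bounds `‖A w‖²`.
  by_contra! hneg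
  obtain ⟨w, hw1, hw2⟩ := exists_sqrt_small hinf
    (δ := -(F ^ 2 - c * E) / (c + 1)) (div_pos (by linarith) (by linarith))
  rw [lt_div_iff₀ (by linarith)] at hw2
  have h1 := hcr' w
  rw [hw1] at h1
  nlinarith [sq_nonneg ‖A w‖, sq_nonneg ‖G.sqrt w‖]

/-- Summing the affine majorant gives `m s + c s E = s (‖A‖ᴳ_E)²`. Upper bounds on mass and energy
suffice because `m, c ≥ 0`. -/
theorem IsSqrtBounded.tsum_le_eNorm {A : G.sqrt.domain →ₗ[ℂ] H} (h : G.IsSqrtBounded A)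
    (hinf : ∀ δ : ℝ, 0 < δ → ∃ φ : G.op.domain, ‖(φ : H)‖ = 1 ∧ ‖G.op φ‖ < δ)
    {E s : ℝ} (hE : 0 < E) (hs : 0 ≤ s) {ι : Type*} {φ : ι → G.sqrt.domain}
    (hφ : ∑' k, ‖(φ k : H)‖ₑ ^ 2 ≤ ENNReal.ofReal s)
    (hGφ : ∑' k, ‖G.sqrt (φ k)‖ₑ ^ 2 ≤ ENNReal.ofReal (s * E)) :
    ∑' k, ‖A (φ k)‖ₑ ^ 2 ≤ (ENNReal.ofReal (Real.sqrt s) * G.eNorm A E) ^ 2 := by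
  obtain ⟨m, c, hm, hc, hmc, hle⟩ := h.exists_majorant hinf hE
  have h1 : (ENNReal.ofReal (Real.sqrt s) * G.eNorm A E) ^ 2 =
      ENNReal.ofReal m * ENNReal.ofReal s + ENNReal.ofReal c * ENNReal.ofReal (s * E) := by
    rw [← ENNReal.ofReal_toReal h.eNorm_ne_top, ← ENNReal.ofReal_mul (by positivity),
      ← ENNReal.ofReal_pow (by positivity), mul_pow, Real.sq_sqrt hs, ← hmc,
      ← ENNReal.ofReal_mul hm, ← ENNReal.ofReal_mul hc,
      ← ENNReal.ofReal_add (by positivity) (by positivity)]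
    congr 1
    ring
  rw [h1]
  calc ∑' k, ‖A (φ k)‖ₑ ^ 2 ≤ ∑' k, (ENNReal.ofReal m * ‖(φ k : H)‖ₑ ^ 2 +
        ENNReal.ofReal c * ‖G.sqrt (φ k)‖ₑ ^ 2) := by
        refine ENNReal.tsum_le_tsum fun k => ?_
        simp only [enorm_sq_eq_ofReal]
        rw [← ENNReal.ofReal_mul hm, ← ENNReal.ofReal_mul hc,
          ← ENNReal.ofReal_add (by positivity) (by positivity)]
        exact ENNReal.ofReal_le_ofReal (hle _)
    _ ≤ _ := by
        rw [ENNReal.tsum_add, ENNReal.tsum_mul_left, ENNReal.tsum_mul_left]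
        gcongr

theorem finiteEnergy_of_energyBall {E : ℝ} {ρ : H →L[ℂ] H} (hρ : ρ ∈ G.energyBall E) :
    ρ ∈ G.finiteEnergy :=
  ⟨hρ.1, hρ.2.2.trans_lt ENNReal.ofReal_lt_top⟩

/-- The continuity bound for `ρ ↦ A ρ B*`. -/
theorem traceNorm_sandwich_sub_le [TopologicalSpace.SeparableSpace H]
    (hinf : ∀ δ : ℝ, 0 < δ → ∃ φ : G.op.domain, ‖(φ : H)‖ = 1 ∧ ‖G.op φ‖ < δ)
    {A B : G.sqrt.domain →ₗ[ℂ] H} (hA : G.IsSqrtBounded A) (hB : G.IsSqrtBounded B)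
    {E ε : ℝ} (hE : 0 < E) (hε : 0 < ε) {ρ σ : H →L[ℂ] H} (hρ : ρ ∈ G.energyBall E)
    (hσ : σ ∈ G.energyBall E) (hρσ : traceNorm (ρ - σ) ≤ ENNReal.ofReal ε) :
    traceNorm (G.sandwich A B ρ - G.sandwich A B σ) ≤ ENNReal.ofReal (Real.sqrt ε) *
      (G.eNorm A E * G.eNorm B (4 * E / ε) + G.eNorm B E * G.eNorm A (4 * E / ε)) := by
  set e := basis H
  have hstate : ∀ τ ∈ G.energyBall E, ∃ x : basisIndex H → G.sqrt.domain,
      (∀ i, (x i : H) = CFC.sqrt τ (e i)) ∧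
      IsWeakSum τ (fun i => (x i : H)) (fun i => (x i : H)) ∧
      ∑' i, ‖(x i : H)‖ₑ ^ 2 ≤ ENNReal.ofReal 1 ∧
      ∑' i, ‖G.sqrt (x i)‖ₑ ^ 2 ≤ ENNReal.ofReal (1 * E) := by
    intro τ hτ
    have h0 := isWeakSum_sqrt e hτ.1.1
    have hs : ∑' i, ‖CFC.sqrt τ (e i)‖ₑ ^ 2 ≠ ∞ := by
      rw [tsum_sqrt_basis _ hτ.1.1]; exact hτ.1.2
    refine ⟨fun i => ⟨_, sqrt_basis_mem_sqrt_domain (finiteEnergy_of_energyBall hτ) i⟩,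
      fun i => rfl, h0, ?_, ?_⟩
    · change ∑' i, ‖CFC.sqrt τ (e i)‖ₑ ^ 2 ≤ _
      rw [← h0.traceNorm_eq, ← h0.ofReal_trace hs]
      exact ENNReal.ofReal_le_ofReal hτ.2.1
    · rw [one_mul]
      exact (G.tsum_sqrt_le_energy (φ := fun i => ⟨CFC.sqrt τ (e i),
        sqrt_basis_mem_sqrt_domain (finiteEnergy_of_energyBall hτ) i⟩) h0 hs).trans hτ.2.2
  -- Using the same basis for `ρ` and `σ` makes `xᵢ - yᵢ = (√ρ - √σ) eᵢ`.
  obtain ⟨x, hx, hxw, hx1, hxE⟩ := hstate ρ hρ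
  obtain ⟨y, hy, hyw, hy1, hyE⟩ := hstate σ hσ
  have hE' : 0 < 4 * E / ε := by positivity
  have hd1 : ∑' i, ‖((x i - y i : G.sqrt.domain) : H)‖ₑ ^ 2 ≤ ENNReal.ofReal ε := by
    simp only [Submodule.coe_sub, hx, hy]
    exact (tsum_enorm_sqrt_sub_sq_le e hρ.1 hσ.1).trans hρσ
  -- `‖u - v‖² ≤ 2(‖u‖² + ‖v‖²)` gives total energy `4E`; relative to the mass `ε` this is the level
  -- `4E / ε`.
  have hdE : ∑' i, ‖G.sqrt (x i - y i)‖ₑ ^ 2 ≤ ENNReal.ofReal (ε * (4 * E / ε)) := by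
    simp only [LinearPMap.map_sub]
    refine (ENNReal.tsum_le_tsum fun i => enorm_sub_sq_le _ _).trans ?_
    rw [ENNReal.tsum_mul_left, ENNReal.tsum_add]
    refine (mul_le_mul_right (add_le_add hxE hyE) _).trans (le_of_eq ?_)
    rw [← ENNReal.ofReal_add (by positivity) (by positivity), ← ENNReal.ofReal_ofNat,
      ← ENNReal.ofReal_mul (by norm_num), mul_div_cancel₀ _ hε.ne']
    congr 1
    ring
  have bound : ∀ {C : G.sqrt.domain →ₗ[ℂ] H}, G.IsSqrtBounded C →
      ∑' i, ‖C (x i)‖ₑ ^ 2 ≤ G.eNorm C E ^ 2 ∧ ∑' i, ‖C (y i)‖ₑ ^ 2 ≤ G.eNorm C E ^ 2 ∧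
      ∑' i, ‖C (x i - y i)‖ₑ ^ 2 ≤
        (ENNReal.ofReal (Real.sqrt ε) * G.eNorm C (4 * E / ε)) ^ 2 := by
    intro C hC
    have h1 := hC.tsum_le_eNorm hinf hE zero_le_one hx1 hxE
    have h2 := hC.tsum_le_eNorm hinf hE zero_le_one hy1 hyE
    rw [Real.sqrt_one, ENNReal.ofReal_one, one_mul] at h1 h2
    exact ⟨h1, h2, hC.tsum_le_eNorm hinf hE' hε.le hd1 hdE⟩
  obtain ⟨hAx, hAy, hAd⟩ := bound hA
  obtain ⟨hBx, hBy, hBd⟩ := bound hB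
  have h1 := tsum_mul_le_of_tsum_sq_le hAd hBx
  have h2 := tsum_mul_le_of_tsum_sq_le hAy hBd
  obtain ⟨T, hT⟩ := exists_hasSum_rankOne (ne_top_of_le_ne_top (ENNReal.mul_ne_top
    (ENNReal.mul_ne_top ENNReal.ofReal_ne_top hA.eNorm_ne_top) hB.eNorm_ne_top) h1)
  obtain ⟨S, hS⟩ := exists_hasSum_rankOne (ne_top_of_le_ne_top (ENNReal.mul_ne_top
    hA.eNorm_ne_top (ENNReal.mul_ne_top ENNReal.ofReal_ne_top hB.eNorm_ne_top)) h2)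
  have hT' := isWeakSum_of_hasSum hT
  have hS' := isWeakSum_of_hasSum hS
  have hρw := (isWeakSum_sandwich hA hB (finiteEnergy_of_energyBall hρ) hxw).2
  have hσw := (isWeakSum_sandwich hA hB (finiteEnergy_of_energyBall hσ) hyw).2
  have heq : G.sandwich A B ρ - G.sandwich A B σ = T + S := by
    ext v
    refine ext_inner_left ℂ fun u => ?_
    rw [_root_.sub_apply, _root_.add_apply, inner_sub_right, inner_add_right]
    have hterm : ∀ i, inner ℂ u (A (x i)) * inner ℂ (B (x i)) v -
        inner ℂ u (A (y i)) * inner ℂ (B (y i)) v = inner ℂ u (A (x i - y i)) *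
          inner ℂ (B (x i)) v + inner ℂ u (A (y i)) * inner ℂ (B (x i - y i)) v := fun i => by
      rw [map_sub, map_sub, inner_sub_right, inner_sub_left]
      ring
    have h3 := (hρw u v).sub (hσw u v)
    simp only [hterm] at h3
    exact h3.unique ((hT' u v).add (hS' u v))
  rw [heq]
  refine (hT'.traceNorm_add_le hS').trans ((add_le_add h1 h2).trans (le_of_eq ?_))
  ring

theorem IsSqrtInfinitesimal.tendsto_eNorm {A : G.sqrt.domain →ₗ[ℂ] H}
    (hA : G.IsSqrtInfinitesimal A) {E : ℝ} (hE : 0 < E) :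
    Filter.Tendsto (fun ε : ℝ => ENNReal.ofReal (Real.sqrt ε) * G.eNorm A (4 * E / ε))
      (nhdsWithin 0 (Set.Ioi 0)) (nhds 0) := by
  rw [ENNReal.tendsto_nhds_zero]
  intro η hη
  obtain ⟨r, hr0, hrη⟩ := ENNReal.lt_iff_exists_nnreal_btwn.1 hη
  have hr : 0 < (r : ℝ) := by exact_mod_cast hr0
  obtain ⟨⟨a₀, b₀, h₀⟩, hA0⟩ := hA
  have hsE : 0 < Real.sqrt E := Real.sqrt_pos.2 hE
  -- In `a√ε + 2b√E`, this `b` keeps the second term below `r / 2`; only then is `ε` made small in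
  -- terms of `a`.
  obtain ⟨b, ⟨a, hab⟩, hb⟩ := exists_lt_of_csInf_lt (s := {b | ∃ a, G.IsBoundPair A a b})
    ⟨b₀, a₀, h₀⟩ (show sInf {b | ∃ a, G.IsBoundPair A a b} < r / (4 * Real.sqrt E) by
      rw [show sInf {b | ∃ a, G.IsBoundPair A a b} = 0 from hA0]; positivity)
  rw [lt_div_iff₀ (by positivity)] at hb
  have hlim : Filter.Tendsto (fun ε : ℝ => a * Real.sqrt ε) (nhdsWithin 0 (Set.Ioi 0))
      (nhds 0) := by
    have h1 : Filter.Tendsto (fun ε : ℝ => a * Real.sqrt ε) (nhds 0) (nhds (a * Real.sqrt 0)) :=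
      (continuous_const.mul Real.continuous_sqrt).tendsto 0
    rw [Real.sqrt_zero, mul_zero] at h1
    exact h1.mono_left nhdsWithin_le_nhds
  filter_upwards [hlim.eventually_lt_const (show (0 : ℝ) < r / 2 by positivity),
    self_mem_nhdsWithin] with ε hε hε0
  have hε0' : 0 < ε := hε0
  have hsε : 0 < Real.sqrt ε := Real.sqrt_pos.2 hε0'
  refine le_trans ?_ hrη.le
  calc ENNReal.ofReal (Real.sqrt ε) * G.eNorm A (4 * E / ε)
      ≤ ENNReal.ofReal (Real.sqrt ε) * ENNReal.ofReal (a + b * Real.sqrt (4 * E / ε)) := by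
        gcongr
        exact hab.eNorm_le
    _ = ENNReal.ofReal (a * Real.sqrt ε + 2 * b * Real.sqrt E) := by
        rw [← ENNReal.ofReal_mul hsε.le, Real.sqrt_div (by positivity),
          Real.sqrt_mul (by norm_num), show (4 : ℝ) = 2 ^ 2 by norm_num,
          Real.sqrt_sq (by norm_num)]
        congr 1
        field_simp
    _ ≤ r := by
        rw [← ENNReal.ofReal_coe_nnreal]
        refine ENNReal.ofReal_le_ofReal ?_
        linarith

theorem tendsto_bound {A B : G.sqrt.domain →ₗ[ℂ] H} (hA : G.IsSqrtInfinitesimal A)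
    (hB : G.IsSqrtInfinitesimal B) {E : ℝ} (hE : 0 < E) :
    Filter.Tendsto (fun ε : ℝ => ENNReal.ofReal (Real.sqrt ε) *
        (G.eNorm A E * G.eNorm B (4 * E / ε) + G.eNorm B E * G.eNorm A (4 * E / ε)))
      (nhdsWithin 0 (Set.Ioi 0)) (nhds 0) := by
  have h1 := ENNReal.Tendsto.const_mul (hB.tendsto_eNorm hE)
    (Or.inr (hA.1.eNorm_ne_top (E := E)))
  have h2 := ENNReal.Tendsto.const_mul (hA.tendsto_eNorm hE)
    (Or.inr (hB.1.eNorm_ne_top (E := E)))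
  have h3 := h1.add h2
  rw [mul_zero, mul_zero, add_zero] at h3
  refine h3.congr fun ε => ?_
  ring

/-! ### Discontinuity for operators that are not infinitesimal -/

theorem exists_energy_eq_of_not_isBoundPair {A : G.sqrt.domain →ₗ[ℂ] H} {a₀ b₀ a b : ℝ}
    (h₀ : G.IsBoundPair A a₀ b₀) (ha : 0 ≤ a) (hb : 0 ≤ b) (ha₀ : a₀ ≤ a)
    (h : ¬ G.IsBoundPair A a b) {E : ℝ} (hE : 0 < E) :
    ∃ φ : G.sqrt.domain, ‖G.sqrt φ‖ ^ 2 = E ∧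
      a ^ 2 * ‖(φ : H)‖ ^ 2 + b ^ 2 * E < ‖A φ‖ ^ 2 := by
  have h1 : ∃ φ : G.sqrt.domain,
      a ^ 2 * ‖(φ : H)‖ ^ 2 + b ^ 2 * ‖G.sqrt φ‖ ^ 2 < ‖A φ‖ ^ 2 := by
    by_contra! h1
    exact h ⟨ha, hb, h1⟩
  obtain ⟨φ, hφ⟩ := h1
  -- At zero energy the pair `(a₀, b₀)` with `a₀ ≤ a` already gives the bound, so a violating vector
  -- can be rescaled to energy exactly `E`.
  have hG : 0 < ‖G.sqrt φ‖ := by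
    by_contra! hG
    have hG0 : ‖G.sqrt φ‖ = 0 := le_antisymm hG (norm_nonneg _)
    have h2 := h₀.2.2 φ
    rw [hG0] at h2 hφ
    nlinarith [mul_le_mul_of_nonneg_right (pow_le_pow_left₀ h₀.1 ha₀ 2) (sq_nonneg ‖(φ : H)‖)]
  set t : ℝ := Real.sqrt E / ‖G.sqrt φ‖ with ht
  have ht0 : 0 < t := div_pos (Real.sqrt_pos.2 hE) hG
  have htn : ‖(t : ℂ)‖ = t := by rw [Complex.norm_real, Real.norm_eq_abs, abs_of_pos ht0]
  have htE : t ^ 2 * ‖G.sqrt φ‖ ^ 2 = E := by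
    rw [ht, div_pow, Real.sq_sqrt hE.le]
    field_simp
  refine ⟨(t : ℂ) • φ, ?_, ?_⟩
  · rw [LinearPMap.map_smul, norm_smul, htn, mul_pow, htE]
  · rw [map_smul, Submodule.coe_smul, norm_smul, norm_smul, htn, mul_pow, mul_pow]
    have h3 := mul_lt_mul_of_pos_left hφ (pow_pos ht0 2)
    rw [← htE]
    linarith

theorem rankOne_mem_energyBall {E : ℝ} (φ : G.sqrt.domain) (h1 : ‖(φ : H)‖ ^ 2 ≤ 1)
    (hE : ‖G.sqrt φ‖ ^ 2 ≤ E) : InnerProductSpace.rankOne ℂ (φ : H) (φ : H) ∈ G.energyBall E := by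
  have hw := isWeakSum_rankOne (φ : H) (φ : H)
  have hs : ∑' _ : Unit, ‖(φ : H)‖ₑ ^ 2 ≠ ∞ := by simp
  have hn : traceNorm (InnerProductSpace.rankOne ℂ (φ : H) (φ : H)) = ‖(φ : H)‖ₑ ^ 2 := by
    rw [hw.traceNorm_eq]; simp
  refine ⟨⟨hw.isPositive, ?_⟩, ?_, ?_⟩
  · rw [IsTraceClass, hn]; simp
  · have h2 := hw.ofReal_trace hs
    rw [hn, enorm_sq_eq_ofReal] at h2
    have h3 := h2.le.trans (ENNReal.ofReal_le_ofReal h1)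
    exact (ENNReal.ofReal_le_ofReal_iff zero_le_one).1 h3
  · refine (G.energy_le (φ := fun _ : Unit => φ) hw hs).trans ?_
    simp only [tsum_fintype, Finset.univ_unique, Finset.sum_singleton, enorm_sq_eq_ofReal]
    exact ENNReal.ofReal_le_ofReal hE

theorem sandwich_rankOne [TopologicalSpace.SeparableSpace H] {A : G.sqrt.domain →ₗ[ℂ] H}
    (hA : G.IsSqrtBounded A) {E : ℝ} (φ : G.sqrt.domain) (h1 : ‖(φ : H)‖ ^ 2 ≤ 1)
    (hE : ‖G.sqrt φ‖ ^ 2 ≤ E) : G.sandwich A A (InnerProductSpace.rankOne ℂ (φ : H) (φ : H)) =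
      InnerProductSpace.rankOne ℂ (A φ) (A φ) :=
  (isWeakSum_sandwich hA hA (finiteEnergy_of_energyBall (rankOne_mem_energyBall φ h1 hE))
    (φ := fun _ : Unit => φ) (isWeakSum_rankOne _ _)).2.unique (isWeakSum_rankOne _ _)

/-- If `A` is not `√G`-infinitesimal, then `ρ ↦ A ρ A*` is discontinuous at `0`. -/
theorem not_continuous_sandwich [TopologicalSpace.SeparableSpace H]
    {A : G.sqrt.domain →ₗ[ℂ] H} (hA : G.IsSqrtBounded A) (hA' : ¬ G.IsSqrtInfinitesimal A)
    {E : ℝ} (hE : 0 < E) :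
    0 ∈ G.energyBall E ∧ ∃ η : ℝ, 0 < η ∧ ∀ δ : ℝ, 0 < δ → ∃ σ ∈ G.energyBall E,
      traceNorm (σ - 0) ≤ ENNReal.ofReal δ ∧
      ENNReal.ofReal η < traceNorm (G.sandwich A A σ - G.sandwich A A 0) := by
  have hz0 : ‖((0 : G.sqrt.domain) : H)‖ ^ 2 ≤ 1 := by simp
  have hzE : ‖G.sqrt (0 : G.sqrt.domain)‖ ^ 2 ≤ E := by
    rw [LinearPMap.map_zero]; simpa using hE.le
  have hzero : InnerProductSpace.rankOne ℂ ((0 : G.sqrt.domain) : H) ((0 : G.sqrt.domain) : H)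
      = 0 := by simp
  have h0mem := rankOne_mem_energyBall (G := G) 0 hz0 hzE
  have h0s := sandwich_rankOne hA 0 hz0 hzE
  rw [hzero] at h0mem h0s
  rw [map_zero, map_zero] at h0s
  rw [h0s]
  obtain ⟨a₀, b₀, h₀⟩ := hA
  have hnn : ∀ b ∈ {b | ∃ a, G.IsBoundPair A a b}, 0 ≤ b := fun b ⟨a, h⟩ => h.2.1
  have hpos : 0 < G.relBound A := lt_of_le_of_ne (Real.sInf_nonneg hnn)
    fun h => hA' ⟨⟨a₀, b₀, h₀⟩, h.symm⟩
  -- Below the infimum no `a` completes `β` to a bound pair, so `a` may be taken as large as needed.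
  set β := G.relBound A / 2 with hβ
  have hβ0 : 0 < β := by positivity
  have hnot : ∀ a, ¬ G.IsBoundPair A a β := fun a h => by
    have h1 : G.relBound A ≤ β := csInf_le ⟨0, hnn⟩ ⟨a, h⟩
    linarith
  refine ⟨h0mem, β ^ 2 * E, by positivity, fun δ hδ => ?_⟩
  set m := min δ 1 with hm
  have hm0 : 0 < m := lt_min hδ one_pos
  -- Then `a² ≥ a₀² + b₀² E / m`, so `‖φ‖² > m` would give `a²‖φ‖² ≥ a₀²‖φ‖² + b₀² E ≥ ‖Aφ‖²`,
  -- against the choice of `φ`.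
  set a := a₀ + Real.sqrt (b₀ ^ 2 * E / m) with ha
  have hsq := Real.sqrt_nonneg (b₀ ^ 2 * E / m)
  obtain ⟨φ, hφE, hφ⟩ := exists_energy_eq_of_not_isBoundPair h₀
    (add_nonneg h₀.1 hsq) hβ0.le (by linarith) (hnot a) hE
  have hle := h₀.2.2 φ
  rw [hφE] at hle
  have hφm : ‖(φ : H)‖ ^ 2 ≤ m := by
    by_contra! hlt
    have h1 : a₀ ^ 2 + b₀ ^ 2 * E / m ≤ a ^ 2 := by
      have h2 := Real.sq_sqrt (show 0 ≤ b₀ ^ 2 * E / m by positivity)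
      rw [ha]
      nlinarith [mul_nonneg h₀.1 hsq]
    have h3 : b₀ ^ 2 * E ≤ b₀ ^ 2 * E / m * ‖(φ : H)‖ ^ 2 := by
      rw [div_mul_eq_mul_div, le_div_iff₀ hm0]
      exact mul_le_mul_of_nonneg_left hlt.le (by positivity)
    nlinarith [mul_le_mul_of_nonneg_right h1 (sq_nonneg ‖(φ : H)‖), mul_pos (pow_pos hβ0 2) hE]
  have hφ1 : ‖(φ : H)‖ ^ 2 ≤ 1 := hφm.trans (min_le_right _ _)
  have hnorm : ∀ x : H, traceNorm (InnerProductSpace.rankOne ℂ x x) = ‖x‖ₑ ^ 2 := fun x => by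
    rw [(isWeakSum_rankOne x x).traceNorm_eq]; simp
  refine ⟨_, rankOne_mem_energyBall φ hφ1 hφE.le, ?_, ?_⟩
  · rw [sub_zero, hnorm, enorm_sq_eq_ofReal]
    exact ENNReal.ofReal_le_ofReal (hφm.trans (min_le_left _ _))
  · rw [sandwich_rankOne ⟨a₀, b₀, h₀⟩ φ hφ1 hφE.le]
    rw [sub_zero, hnorm, enorm_sq_eq_ofReal]
    have h5 : β ^ 2 * E < ‖A φ‖ ^ 2 := by
      nlinarith [mul_nonneg (sq_nonneg a) (sq_nonneg ‖(φ : H)‖)]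
    exact (ENNReal.ofReal_lt_ofReal_iff (lt_trans (by positivity) h5)).2 h5

end PosOp

end OpENorm

/-! ### Assembly of the theorem -/

theorem corollary2 {H : Type*} [NormedAddCommGroup H] [InnerProductSpace ℂ H] [CompleteSpace H]
    [TopologicalSpace.SeparableSpace H] (G : OpENorm.PosOp H)
    (hunbounded : ∀ C : ℝ, ∃ φ : G.op.domain, C * ‖(φ : H)‖ < ‖G.op φ‖)
    (hinf : ∀ δ : ℝ, 0 < δ → ∃ φ : G.op.domain, ‖(φ : H)‖ = 1 ∧ ‖G.op φ‖ < δ) :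
    -- `A ρ B*` is a well defined trace class operator
    (∀ A B : G.sqrt.domain →ₗ[ℂ] H, G.IsSqrtBounded A → G.IsSqrtBounded B →
      ∀ ρ ∈ G.finiteEnergy,
        G.IsSandwich A B ρ (G.sandwich A B ρ) ∧ OpENorm.IsTraceClass (G.sandwich A B ρ)) ∧
    (∀ A B : G.sqrt.domain →ₗ[ℂ] H, G.IsSqrtInfinitesimal A → G.IsSqrtInfinitesimal B →
      ∀ E : ℝ, 0 < E →
        -- uniform continuity in the trace norm
        (∀ η : ℝ, 0 < η → ∃ δ : ℝ, 0 < δ ∧ ∀ ρ ∈ G.energyBall E, ∀ σ ∈ G.energyBall E,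
          OpENorm.traceNorm (ρ - σ) ≤ ENNReal.ofReal δ →
          OpENorm.traceNorm (G.sandwich A B ρ - G.sandwich A B σ) ≤ ENNReal.ofReal η) ∧
        -- the continuity bound
        (∀ ε : ℝ, 0 < ε → ∀ ρ ∈ G.energyBall E, ∀ σ ∈ G.energyBall E,
          OpENorm.traceNorm (ρ - σ) ≤ ENNReal.ofReal ε →
          OpENorm.traceNorm (G.sandwich A B ρ - G.sandwich A B σ) ≤
            ENNReal.ofReal (Real.sqrt ε) *
              (G.eNorm A E * G.eNorm B (4 * E / ε) + G.eNorm B E * G.eNorm A (4 * E / ε))) ∧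
        -- its right hand side is `o(1)` as `ε → 0+`
        Filter.Tendsto (fun ε : ℝ => ENNReal.ofReal (Real.sqrt ε) *
              (G.eNorm A E * G.eNorm B (4 * E / ε) + G.eNorm B E * G.eNorm A (4 * E / ε)))
          (nhdsWithin 0 (Set.Ioi 0)) (nhds 0)) ∧
    (∀ A : G.sqrt.domain →ₗ[ℂ] H, G.IsSqrtBounded A → ¬ G.IsSqrtInfinitesimal A →
      ∀ E : ℝ, 0 < E →
        -- discontinuity in the trace norm
        ¬ ∀ ρ ∈ G.energyBall E, ∀ η : ℝ, 0 < η → ∃ δ : ℝ, 0 < δ ∧ ∀ σ ∈ G.energyBall E,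
          OpENorm.traceNorm (σ - ρ) ≤ ENNReal.ofReal δ →
          OpENorm.traceNorm (G.sandwich A A σ - G.sandwich A A ρ) ≤ ENNReal.ofReal η) := by
  refine ⟨fun A B hA hB ρ hρ => OpENorm.PosOp.isSandwich_sandwich hA hB hρ,
    fun A B hA hB E hE => ?_, fun A hA hA' E hE hcont => ?_⟩
  · have hbound : ∀ ε : ℝ, 0 < ε → ∀ ρ ∈ G.energyBall E, ∀ σ ∈ G.energyBall E,
        OpENorm.traceNorm (ρ - σ) ≤ ENNReal.ofReal ε →
        OpENorm.traceNorm (G.sandwich A B ρ - G.sandwich A B σ) ≤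
          ENNReal.ofReal (Real.sqrt ε) *
            (G.eNorm A E * G.eNorm B (4 * E / ε) + G.eNorm B E * G.eNorm A (4 * E / ε)) :=
      fun ε hε ρ hρ σ hσ h =>
        OpENorm.PosOp.traceNorm_sandwich_sub_le hinf hA.1 hB.1 hE hε hρ hσ h
    have hlim := OpENorm.PosOp.tendsto_bound hA hB hE
    refine ⟨fun η hη => ?_, hbound, hlim⟩
    obtain ⟨δ, hδ, hδ0⟩ := ((ENNReal.tendsto_nhds_zero.1 hlim (ENNReal.ofReal η)
      (ENNReal.ofReal_pos.2 hη)).and self_mem_nhdsWithin).exists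
    exact ⟨δ, hδ0, fun ρ hρ σ hσ h => (hbound δ hδ0 ρ hρ σ hσ h).trans hδ⟩
  · obtain ⟨h0, η, hη, hdisc⟩ := OpENorm.PosOp.not_continuous_sandwich hA hA' hE
    obtain ⟨δ, hδ, h⟩ := hcont 0 h0 η hη
    obtain ⟨σ, hσ, hσδ, hση⟩ := hdisc δ hδ
    exact (h σ hσ hσδ).not_gt hση
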